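/- All manifolds, maps and sections are smooth ($C^\infty$, real, manifolds second countable and Hausdorff). Let $\pi\colon E\to\mathbb{R}$ be a bundle over the real line (a surjective submersion), $\dim E=n+1$, let $k\ge 1$, and write $t$ for the canonical coordinate of $\mathbb{R}$. For $r\geq 0$ let $J^r\pi$ be the manifold of $r$-jets of local sections of $\pi$, with projections $\pi^r_s\colon J^r\pi\to J^s\pi$ ($s\le r$) and $\bar\pi^r\colon J^r\pi\to\mathbb{R}$; a fibred chart $(t,q^A)$ of $E$ induces coordinates $(t,q_0^A,\dots,q_r^A)$ on $J^r\pi$, with $q_i^A(j^r_t\phi)=\frac{d^i (q^A\circ\phi)}{dt^i}(t)$. Let $J^{k-1}\pi^*={\rm T}^*(J^{k-1}\pi)/(\bar\pi^{k-1})^*{\rm T}^*\mathbb{R}$ and $$\mathcal{W}=J^{2k-1}\pi\times_{J^{k-1}\pi}{\rm T}^*(J^{k-1}\pi),\qquad \mathcal{W}_r=J^{2k-1}\pi\times_{J^{k-1}\pi}J^{k-1}\pi^*,\qquad \mu_{\mathcal W}\colon\mathcal{W}\to\mathcal{W}_r,\ (\bar y,\alpha)\mapsto(\bar y,[\alpha]).$$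 Let $\rho_{\mathbb R}\colon\mathcal W\to\mathbb R$ and $\rho_1\colon\mathcal W\to J^{2k-1}\pi$ be the natural projections. The coupling $1$-form $\hat{\mathcal C}$ of $\mathcal W$ is given, for $w=(\bar y,\alpha)$ and $u\in{\rm T}_w\mathcal W$, by $\langle\hat{\mathcal C}(w)\mid u\rangle=\langle\alpha\mid{\rm T}_w(j^{k-1}\phi\circ\rho_{\mathbb R})(u)\rangle$, where $\phi$ is any local section representing $\bar y$. Let $\mathcal L$ be a $k$-th order Lagrangian density, i.e. a $\bar\pi^k$-semibasic $1$-form on $J^k\pi$, put $\hat{\mathcal L}=(\pi^{2k-1}_k\circ\rho_1)^*\mathcal L$, and write $\hat{\mathcal L}=\hat L\,dt$. Finally let $$\mathcal W_o=\{w\in\mathcal W:\hat{\mathcal L}(w)=\hat{\mathcal C}(w)\}\overset{j_o}{\hookrightarrow}\mathcal W .$$ Then: (1) $\mathcal W_o$ is an embedded submanifold of $\mathcal W$ of codimension one. (2) $\mathcal W_o$ is transverse to $\mu_{\mathcal W}$, that is, ${\rm T}_w\mathcal W={\rm T}_w\mathcal W_o\oplus\ker{\rm T}_w\mu_{\mathcal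 W}$ for every $w\in\mathcal W_o$. (3) $\mu_{\mathcal W}\circ j_o\colon\mathcal W_o\to\mathcal W_r$ is a diffeomorphism. (4) Consequently $\hat h=j_o\circ(\mu_{\mathcal W}\circ j_o)^{-1}\colon\mathcal W_r\to\mathcal W$ is a smooth section of $\mu_{\mathcal W}$ with image $\mathcal W_o$ (a Hamiltonian section). In the coordinates $(t,q_0^A,\dots,q_{2k-1}^A,p,p_A^0,\dots,p_A^{k-1})$ of $\mathcal W$ induced by any fibred chart of $E$, where $\alpha=p\,dt+\sum_{i=0}^{k-1}p_A^i\,dq_i^A$, it is given by $p=-\hat H$ with the local Hamiltonian function $$\hat H=-\hat L+\sum_{i=0}^{k-1}p_A^i\,q_{i+1}^A .$$ -/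

import Mathlib

open Set Filter Topology Bundle Manifold
open scoped ContDiff

noncomputable section

set_option linter.unusedSectionVars false

namespace HighOrderMechanics

/-- The fibre model `ℝⁿ`, in which the fibre coordinates `q = (q^A)` take their values. -/
abbrev FibreModel (n : ℕ) : Type := EuclideanSpace ℝ (Fin n)

/-- A configuration bundle `π : E → ℝ` over the real line, with `dim E = n + 1`: a smooth
surjective submersion. -/
structure ConfigBundle (n : ℕ) (E : Type*) [TopologicalSpace E]
    [ChartedSpace (EuclideanSpace ℝ (Fin (n + 1))) E] where
  /-- the projection `π` -/
  proj : E → ℝ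
  surjective : Function.Surjective proj
  isSubmersion : IsSubmersion (𝓡 (n + 1)) 𝓘(ℝ, ℝ) ∞ proj

variable {n : ℕ} {E : Type*} [TopologicalSpace E]
  [ChartedSpace (EuclideanSpace ℝ (Fin (n + 1))) E]

/-! ### Adapted charts -/

/-- A chart `(t, q^A)` of `E` adapted to the bundle structure: a diffeomorphism of an open subset
of `E` onto an open subset of `ℝ × ℝⁿ` whose first component is `π`. -/
structure AdaptedChart (P : ConfigBundle n E) where
  chart : OpenPartialHomeomorph E (ℝ × FibreModel n)
  contMDiffOn : ContMDiffOn (𝓡 (n + 1)) 𝓘(ℝ, ℝ × FibreModel n) ∞ chart chart.source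
  contMDiffOn_symm : ContMDiffOn 𝓘(ℝ, ℝ × FibreModel n) (𝓡 (n + 1)) ∞ chart.symm chart.target
  fst_eq : ∀ x ∈ chart.source, (chart x).1 = P.proj x

theorem exists_adaptedChart [IsManifold (𝓡 (n + 1)) ∞ E] (P : ConfigBundle n E) (x : E) :
    ∃ e : AdaptedChart P, x ∈ e.chart.source := by
  obtain ⟨F, _, _, hF⟩ := P.isSubmersion
  have h := hF x
  let A := h.equiv
  have : FiniteDimensional ℝ (ℝ × F) := A.toLinearEquiv.finiteDimensional
  have : FiniteDimensional ℝ F :=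
    FiniteDimensional.of_injective (LinearMap.inr ℝ ℝ F) LinearMap.inr_injective
  have hr : Module.finrank ℝ F = Module.finrank ℝ (FibreModel n) := by
    have h1 := A.toLinearEquiv.finrank_eq
    simp only [finrank_euclideanSpace, Fintype.card_fin, Module.finrank_prod,
      Module.finrank_self] at h1 ⊢
    omega
  let B : F ≃L[ℝ] FibreModel n := ContinuousLinearEquiv.ofFinrankEq hr
  let c : OpenPartialHomeomorph E (ℝ × FibreModel n) :=
    (h.domChart.trans A.toHomeomorph.toOpenPartialHomeomorph).trans
      (h.codChart.symm.prod B.toHomeomorph.toOpenPartialHomeomorph)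
  have key : ∀ y ∈ h.domChart.source, (A (h.domChart y)).1 = h.codChart (P.proj y) := by
    intro y hy
    have h1 : h.domChart y ∈ (h.domChart.extend (𝓡 (n + 1))).target := by
      simpa using h.domChart.map_source hy
    have h2 := h.writtenInCharts h1
    simpa [h.domChart.left_inv hy] using h2.symm
  have hcs : ∀ y, y ∈ c.source ↔ y ∈ h.domChart.source := by
    intro y
    simp only [c, OpenPartialHomeomorph.trans_source, mem_inter_iff, mem_preimage]
    constructor
    · intro hy; exact hy.1.1
    · intro hy
      refine ⟨⟨hy, by simp⟩, ?_⟩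
      have : A (h.domChart y) ∈ (h.codChart.symm.prod
          B.toHomeomorph.toOpenPartialHomeomorph).source := by
        simp only [OpenPartialHomeomorph.prod_source, mem_prod]
        refine ⟨?_, by simp⟩
        rw [key y hy]
        exact h.codChart.map_source (h.source_subset_preimage_source hy)
      exact this
  have hc : ∀ y, c y = (h.codChart.symm (A (h.domChart y)).1, B (A (h.domChart y)).2) :=
    fun y => rfl
  have hcsymm : ∀ z, c.symm z = h.domChart.symm (A.symm (h.codChart z.1, B.symm z.2)) :=
    fun z => rfl
  refine ⟨⟨c, ?_, ?_, ?_⟩, (hcs x).2 h.mem_domChart_source⟩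
  · have h1 : ContMDiffOn (𝓡 (n + 1)) 𝓘(ℝ, EuclideanSpace ℝ (Fin (n + 1))) ∞ h.domChart
        h.domChart.source := contMDiffOn_of_mem_maximalAtlas h.domChart_mem_maximalAtlas
    have h2 : ContMDiffOn 𝓘(ℝ, ℝ) 𝓘(ℝ, ℝ) ∞ h.codChart.symm h.codChart.target :=
      contMDiffOn_symm_of_mem_maximalAtlas h.codChart_mem_maximalAtlas
    have h3 : ContMDiffOn (𝓡 (n + 1)) 𝓘(ℝ, ℝ × F) ∞ (fun y => A (h.domChart y)) c.source :=
      (A.contDiff.contMDiff.comp_contMDiffOn h1).mono fun y hy => (hcs y).1 hy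
    have h4 : ContMDiffOn (𝓡 (n + 1)) 𝓘(ℝ, ℝ) ∞ (fun y => (A (h.domChart y)).1) c.source :=
      (contDiff_fst (𝕜 := ℝ) (E := ℝ) (F := F)).contMDiff.comp_contMDiffOn h3
    have h5 : ContMDiffOn (𝓡 (n + 1)) 𝓘(ℝ, FibreModel n) ∞ (fun y => B (A (h.domChart y)).2)
        c.source :=
      (B.contDiff.comp (contDiff_snd (𝕜 := ℝ) (E := ℝ) (F := F))).contMDiff.comp_contMDiffOn h3
    refine ((h2.comp h4 ?_).prodMk_space h5)
    intro y hy
    have hy' := (hcs y).1 hy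
    simp only [mem_preimage]
    rw [key y hy']
    exact h.codChart.map_source (h.source_subset_preimage_source hy')
  · have h1 : ContMDiffOn 𝓘(ℝ, EuclideanSpace ℝ (Fin (n + 1))) (𝓡 (n + 1)) ∞ h.domChart.symm
        h.domChart.target := contMDiffOn_symm_of_mem_maximalAtlas h.domChart_mem_maximalAtlas
    have h2 : ContMDiffOn 𝓘(ℝ, ℝ) 𝓘(ℝ, ℝ) ∞ h.codChart h.codChart.source :=
      contMDiffOn_of_mem_maximalAtlas h.codChart_mem_maximalAtlas
    have hct : ∀ z ∈ c.target, z.1 ∈ h.codChart.source ∧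
        A.symm (h.codChart z.1, B.symm z.2) ∈ h.domChart.target := by
      intro z hz
      have e1 := c.map_target hz
      have e2 := c.right_inv hz
      have e3 := (hcs _).1 e1
      have e4 := key _ e3
      have e5 := hc (c.symm z)
      rw [e2] at e5
      have e6 : z.1 = P.proj (c.symm z) := by
        refine (congrArg Prod.fst e5).trans ?_
        simp only; rw [e4]
        exact h.codChart.left_inv (h.source_subset_preimage_source e3)
      have e7 : z.1 ∈ h.codChart.source := by
        rw [e6]; exact h.source_subset_preimage_source e3
      refine ⟨e7, ?_⟩
      have e8 : A.symm (h.codChart z.1, B.symm z.2) = h.domChart (c.symm z) := by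
        rw [ContinuousLinearEquiv.symm_apply_eq]
        refine Prod.ext ?_ ?_
        · simp only; rw [e6, ← e4]
        · have e9 := congrArg Prod.snd e5
          simp only at e9 ⊢; rw [B.symm_apply_eq]; exact e9
      rw [e8]; exact h.domChart.map_source e3
    have h3 : ContMDiffOn 𝓘(ℝ, ℝ × FibreModel n) 𝓘(ℝ, ℝ) ∞ (fun z => h.codChart z.1) c.target :=
      h2.comp (contDiff_fst (𝕜 := ℝ) (E := ℝ) (F := FibreModel n)).contMDiff.contMDiffOn
        fun z hz => (hct z hz).1
    have h4 : ContMDiffOn 𝓘(ℝ, ℝ × FibreModel n) 𝓘(ℝ, F) ∞ (fun z => B.symm z.2) c.target :=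
      (B.symm.contDiff.comp
        (contDiff_snd (𝕜 := ℝ) (E := ℝ) (F := FibreModel n))).contMDiff.contMDiffOn
    have h5 := A.symm.contDiff.contMDiff.comp_contMDiffOn (h3.prodMk_space h4) (n := ∞)
    exact h1.comp h5 fun z hz => (hct z hz).2
  · intro y hy
    have hy' := (hcs y).1 hy
    rw [hc]
    simp only
    rw [key y hy']
    exact h.codChart.left_inv (h.source_subset_preimage_source hy')

/-- A choice of an adapted chart around each point. -/
def adaptedAt [IsManifold (𝓡 (n + 1)) ∞ E] (P : ConfigBundle n E) (x : E) : AdaptedChart P :=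
  (exists_adaptedChart P x).choose

theorem mem_adaptedAt [IsManifold (𝓡 (n + 1)) ∞ E] (P : ConfigBundle n E) (x : E) :
    x ∈ (adaptedAt P x).chart.source :=
  (exists_adaptedChart P x).choose_spec

/-! ### Jets of sections -/

/-- `φ` is a (smooth, local) section of `π` defined around `t`. -/
def IsLocalSection (P : ConfigBundle n E) (φ : ℝ → E) (t : ℝ) : Prop :=
  ∀ᶠ s in 𝓝 t, ContMDiffAt 𝓘(ℝ, ℝ) (𝓡 (n + 1)) ∞ φ s ∧ P.proj (φ s) = s

/-- A local section of `π` together with a point of its domain. -/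
structure PointedSection (P : ConfigBundle n E) where
  time : ℝ
  sec : ℝ → E
  isLocalSection : IsLocalSection P sec time

/-- Two pointed sections have the same `k`-jet if they are based at the same instant `t`, have the
same value there, and have the same derivatives at `t` up to order `k`, computed in a chart. -/
structure SameJet {P : ConfigBundle n E} (k : ℕ) (a b : PointedSection P) : Prop where
  time_eq : a.time = b.time
  sec_eq : a.sec a.time = b.sec b.time
  deriv_eq : ∀ i ≤ k, iteratedDeriv i (extChartAt (𝓡 (n + 1)) (a.sec a.time) ∘ a.sec) a.time =
    iteratedDeriv i (extChartAt (𝓡 (n + 1)) (b.sec b.time) ∘ b.sec) b.time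

/-- Having the same `k`-jet is an equivalence relation. -/
def jetSetoid (P : ConfigBundle n E) (k : ℕ) : Setoid (PointedSection P) where
  r := SameJet k
  iseqv :=
    { refl := fun _ => ⟨rfl, rfl, fun _ _ => rfl⟩
      symm := fun h => ⟨h.1.symm, h.2.symm, fun i hi => (h.3 i hi).symm⟩
      trans := fun h h' => ⟨h.1.trans h'.1, h.2.trans h'.2,
        fun i hi => (h.3 i hi).trans (h'.3 i hi)⟩ }

/-- The `k`-th order jet bundle `J^k π`, as a set. -/
def Jet (P : ConfigBundle n E) (k : ℕ) : Type _ := Quotient (jetSetoid P k)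

namespace Jet

variable {P : ConfigBundle n E} {k : ℕ}

/-- The `k`-jet `j^k_t φ`. -/
def mk (k : ℕ) (a : PointedSection P) : Jet P k := Quotient.mk (jetSetoid P k) a

/-- A representative of a jet. -/
def rep (j : Jet P k) : PointedSection P := Quotient.out j

theorem mk_rep (j : Jet P k) : mk k j.rep = j := Quotient.out_eq j

theorem mk_eq_mk {a b : PointedSection P} : mk k a = mk k b ↔ SameJet k a b := Quotient.eq

/-- The projection `π̄^k : J^k π → ℝ`. -/
def time (j : Jet P k) : ℝ := Quotient.lift PointedSection.time (fun _ _ h => SameJet.time_eq h) j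

/-- The projection `π^k : J^k π → E`. -/
def point (j : Jet P k) : E :=
  Quotient.lift (fun a : PointedSection P => a.sec a.time) (fun _ _ h => SameJet.sec_eq h) j

/-- The projection `π^k_r : J^k π → J^r π`. -/
def projTo (r : ℕ) (h : r ≤ k) (j : Jet P k) : Jet P r :=
  Quotient.map id (fun a b (hab : SameJet k a b) => show SameJet r a b from
    ⟨hab.1, hab.2, fun i hi => hab.3 i (hi.trans h)⟩) j

@[simp] theorem time_mk (a : PointedSection P) : (mk k a).time = a.time := rfl
@[simp] theorem point_mk (a : PointedSection P) : (mk k a).point = a.sec a.time := rfl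
@[simp] theorem projTo_mk {r : ℕ} (h : r ≤ k) (a : PointedSection P) :
    (mk k a).projTo r h = mk r a := rfl

theorem time_rep (j : Jet P k) : j.rep.time = j.time := by
  conv_rhs => rw [← mk_rep j]
  rfl

theorem point_rep (j : Jet P k) : j.rep.sec j.rep.time = j.point := by
  conv_rhs => rw [← mk_rep j]
  rfl

theorem time_projTo {r : ℕ} (h : r ≤ k) (j : Jet P k) : (j.projTo r h).time = j.time := by
  rw [← mk_rep j]; rfl

theorem point_projTo {r : ℕ} (h : r ≤ k) (j : Jet P k) : (j.projTo r h).point = j.point := by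
  rw [← mk_rep j]; rfl

open Classical in
/-- The prolongation `s ↦ j^k_s φ` of a local section `φ` given around `t` (outside the domain of
`φ`, where it is irrelevant, the map is given the value `j^k_t φ`). -/
def prolong (k : ℕ) (a : PointedSection P) (s : ℝ) : Jet P k :=
  if h : IsLocalSection P a.sec s then mk k ⟨s, a.sec, h⟩ else mk k a

/-- The coordinates `q_i = dⁱ(q ∘ φ)/dtⁱ` of a pointed section in an adapted chart `(t, q)`. -/
def _root_.HighOrderMechanics.PointedSection.coord (e : AdaptedChart P) (i : ℕ)
    (a : PointedSection P) : FibreModel n :=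
  iteratedDeriv i (fun s => (e.chart (a.sec s)).2) a.time

/-- The coordinate `q_i`, `i ≤ k`, on the part of `J^k π` that lies over the domain of an adapted
chart `(t, q)`. -/
def coord (e : AdaptedChart P) (i : ℕ) (j : Jet P k) : FibreModel n := j.rep.coord e i

end Jet

theorem PointedSection.contMDiffAt {P : ConfigBundle n E} (a : PointedSection P) :
    ContMDiffAt 𝓘(ℝ, ℝ) (𝓡 (n + 1)) ∞ a.sec a.time := (a.isLocalSection.self_of_nhds).1

theorem PointedSection.proj_sec {P : ConfigBundle n E} (a : PointedSection P) :
    P.proj (a.sec a.time) = a.time := (a.isLocalSection.self_of_nhds).2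

theorem Jet.proj_point {P : ConfigBundle n E} {k : ℕ} (j : Jet P k) :
    P.proj j.point = j.time := by
  rw [← j.point_rep, ← j.time_rep, j.rep.proj_sec]

theorem iteratedDeriv_comp_congr {X Y : Type*} [NormedAddCommGroup X] [NormedSpace ℝ X]
    [NormedAddCommGroup Y] [NormedSpace ℝ Y] {f g : ℝ → X} {F : X → Y} {t : ℝ} {k : ℕ}
    (hf : ContDiffAt ℝ ∞ f t) (hg : ContDiffAt ℝ ∞ g t) (hF : ContDiffAt ℝ ∞ F (f t))
    (h : ∀ i ≤ k, iteratedDeriv i f t = iteratedDeriv i g t) {i : ℕ} (hi : i ≤ k) :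
    iteratedDeriv i (F ∘ f) t = iteratedDeriv i (F ∘ g) t := by
  have h0 : f t = g t := by simpa using h 0 (Nat.zero_le _)
  have hi' : (i : WithTop ℕ∞) ≤ ∞ := by exact_mod_cast le_top
  rw [iteratedDeriv_vcomp_eq_sum_orderedFinpartition hF hf hi',
    iteratedDeriv_vcomp_eq_sum_orderedFinpartition (h0 ▸ hF) hg hi', ← h0]
  refine Finset.sum_congr rfl fun c _ => ?_
  congr 1
  ext1 m
  exact h _ ((c.partSize_le m).trans hi)

section Charts

variable {P : ConfigBundle n E} {k : ℕ}

theorem AdaptedChart.contDiffAt_extChart (e : AdaptedChart P) {x : E}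
    (hx : x ∈ e.chart.source) :
    ContDiffAt ℝ ∞ (extChartAt (𝓡 (n + 1)) x ∘ e.chart.symm) (e.chart x) := by
  rw [← contMDiffAt_iff_contDiffAt]
  have h1 : ContMDiffAt 𝓘(ℝ, ℝ × FibreModel n) (𝓡 (n + 1)) ∞ e.chart.symm (e.chart x) :=
    e.contMDiffOn_symm.contMDiffAt (e.chart.open_target.mem_nhds (e.chart.map_source hx))
  have h2 : ContMDiffAt (𝓡 (n + 1)) 𝓘(ℝ, EuclideanSpace ℝ (Fin (n + 1))) ∞
      (extChartAt (𝓡 (n + 1)) x) (e.chart.symm (e.chart x)) := by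
    rw [e.chart.left_inv hx]
    exact contMDiffAt_extChartAt
  exact h2.comp _ h1

theorem AdaptedChart.contDiffAt_comp (e : AdaptedChart P) (a : PointedSection P)
    (h : a.sec a.time ∈ e.chart.source) : ContDiffAt ℝ ∞ (e.chart ∘ a.sec) a.time := by
  rw [← contMDiffAt_iff_contDiffAt]
  exact (e.contMDiffOn.contMDiffAt (e.chart.open_source.mem_nhds h)).comp _ a.contMDiffAt

theorem AdaptedChart.eventually_mem (e : AdaptedChart P) (a : PointedSection P)
    (h : a.sec a.time ∈ e.chart.source) : ∀ᶠ s in 𝓝 a.time, a.sec s ∈ e.chart.source :=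
  a.contMDiffAt.continuousAt.preimage_mem_nhds (e.chart.open_source.mem_nhds h)

theorem AdaptedChart.eventually_eq (e : AdaptedChart P) (a : PointedSection P)
    (h : a.sec a.time ∈ e.chart.source) :
    e.chart ∘ a.sec =ᶠ[𝓝 a.time] fun s => (s, (e.chart (a.sec s)).2) := by
  filter_upwards [e.eventually_mem a h, a.isLocalSection] with s hs hs'
  exact Prod.ext ((e.fst_eq _ hs).trans hs'.2) rfl

theorem AdaptedChart.contDiffAt_snd (e : AdaptedChart P) (a : PointedSection P)
    (h : a.sec a.time ∈ e.chart.source) :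
    ContDiffAt ℝ ∞ (fun s => (e.chart (a.sec s)).2) a.time :=
  _root_.contDiffAt_snd.comp _ (e.contDiffAt_comp a h)

/-- The value in `ℝ × ℝⁿ` of the `i`-th derivative at `t` of `s ↦ (s, q(s))`, given the
derivatives `Q` of `q`. -/
def liftCoord (t : ℝ) (Q : ℕ → FibreModel n) (i : ℕ) : ℝ × FibreModel n :=
  (if i = 0 then t else if i = 1 then 1 else 0, Q i)

theorem iteratedDeriv_graph {q : ℝ → FibreModel n} {t : ℝ} (hq : ContDiffAt ℝ ∞ q t) (i : ℕ) :
    iteratedDeriv i (fun s => (s, q s)) t = liftCoord t (fun i => iteratedDeriv i q t) i := by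
  have hi' : (i : WithTop ℕ∞) ≤ ∞ := by exact_mod_cast le_top
  have e1 : (fun s : ℝ => (s, q s)) =
      (fun s => ContinuousLinearMap.inl ℝ ℝ (FibreModel n) s) +
        fun s => ContinuousLinearMap.inr ℝ ℝ (FibreModel n) (q s) := by
    ext1 s; simp
  have c1 : ContDiffAt ℝ i (fun s => ContinuousLinearMap.inl ℝ ℝ (FibreModel n) s) t :=
    (ContinuousLinearMap.contDiff _).contDiffAt
  have c2 : ContDiffAt ℝ i (fun s => ContinuousLinearMap.inr ℝ ℝ (FibreModel n) (q s)) t :=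
    (ContinuousLinearMap.contDiff _).contDiffAt.comp t (hq.of_le hi')
  rw [e1, iteratedDeriv_add c1 c2]
  have e2 : iteratedDeriv i (fun s => ContinuousLinearMap.inr ℝ ℝ (FibreModel n) (q s)) t =
      (0, iteratedDeriv i q t) := by
    have := ContinuousLinearMap.iteratedFDeriv_comp_left
      (ContinuousLinearMap.inr ℝ ℝ (FibreModel n)) (hq.of_le hi') (le_refl _)
    simp only [iteratedDeriv_eq_iteratedFDeriv]
    change iteratedFDeriv ℝ i (⇑(ContinuousLinearMap.inr ℝ ℝ (FibreModel n)) ∘ q) t _ = _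
    rw [this]; simp
  have e3 : iteratedDeriv i (fun s => ContinuousLinearMap.inl ℝ ℝ (FibreModel n) s) t =
      (if i = 0 then t else if i = 1 then 1 else 0, 0) := by
    have := ContinuousLinearMap.iteratedFDeriv_comp_left
      (ContinuousLinearMap.inl ℝ ℝ (FibreModel n)) (contDiffAt_id (x := t) (n := i)) (le_refl _)
    simp only [iteratedDeriv_eq_iteratedFDeriv]
    change iteratedFDeriv ℝ i (⇑(ContinuousLinearMap.inl ℝ ℝ (FibreModel n)) ∘ id) t _ = _
    rw [this]
    simp [← iteratedDeriv_eq_iteratedFDeriv, iteratedDeriv_id]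
  rw [e2, e3, liftCoord]
  simp

theorem AdaptedChart.iteratedDeriv_comp (e : AdaptedChart P) (a : PointedSection P)
    (h : a.sec a.time ∈ e.chart.source) (i : ℕ) :
    iteratedDeriv i (e.chart ∘ a.sec) a.time = liftCoord a.time (fun i => a.coord e i) i := by
  rw [(e.eventually_eq a h).iteratedDeriv_eq]
  exact iteratedDeriv_graph (e.contDiffAt_snd a h) i

variable [IsManifold (𝓡 (n + 1)) ∞ E]

theorem AdaptedChart.contDiffAt_extChart_symm (e : AdaptedChart P) {x : E}
    (hx : x ∈ e.chart.source) :
    ContDiffAt ℝ ∞ (e.chart ∘ (extChartAt (𝓡 (n + 1)) x).symm) (extChartAt (𝓡 (n + 1)) x x) := by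
  rw [← contMDiffAt_iff_contDiffAt]
  have h1 : ContMDiffAt 𝓘(ℝ, EuclideanSpace ℝ (Fin (n + 1))) (𝓡 (n + 1)) ∞
      (extChartAt (𝓡 (n + 1)) x).symm (extChartAt (𝓡 (n + 1)) x x) :=
    (contMDiffOn_extChartAt_symm x).contMDiffAt (extChartAt_target_mem_nhds x)
  have h2 : ContMDiffAt (𝓡 (n + 1)) 𝓘(ℝ, ℝ × FibreModel n) ∞ e.chart
      ((extChartAt (𝓡 (n + 1)) x).symm (extChartAt (𝓡 (n + 1)) x x)) := by
    rw [extChartAt_to_inv]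
    exact e.contMDiffOn.contMDiffAt (e.chart.open_source.mem_nhds hx)
  exact h2.comp _ h1

/-- Equality of jets may be tested in any adapted chart. -/
theorem sameJet_iff (e : AdaptedChart P) (a b : PointedSection P)
    (ha : a.sec a.time ∈ e.chart.source) (hb : b.sec b.time ∈ e.chart.source) :
    SameJet k a b ↔ a.time = b.time ∧ ∀ i ≤ k, a.coord e i = b.coord e i := by
  constructor
  · rintro ⟨h1, h2, h3⟩
    refine ⟨h1, fun i hi => ?_⟩
    have key : iteratedDeriv i (e.chart ∘ a.sec) a.time =
        iteratedDeriv i (e.chart ∘ b.sec) b.time := by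
      set x := a.sec a.time with hx
      have ca : ContDiffAt ℝ ∞ (extChartAt (𝓡 (n + 1)) x ∘ a.sec) a.time := by
        rw [← contMDiffAt_iff_contDiffAt]
        exact contMDiffAt_extChartAt.comp _ a.contMDiffAt
      have cb : ContDiffAt ℝ ∞ (extChartAt (𝓡 (n + 1)) x ∘ b.sec) b.time := by
        rw [← contMDiffAt_iff_contDiffAt, h2]
        exact contMDiffAt_extChartAt.comp _ b.contMDiffAt
      rw [← h2] at h3
      rw [← h1] at h3 cb
      have := iteratedDeriv_comp_congr ca cb
        (F := e.chart ∘ (extChartAt (𝓡 (n + 1)) x).symm) (e.contDiffAt_extChart_symm ha) h3 hi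
      have ea : (e.chart ∘ (extChartAt (𝓡 (n + 1)) x).symm) ∘ (extChartAt (𝓡 (n + 1)) x ∘ a.sec)
          =ᶠ[𝓝 a.time] e.chart ∘ a.sec := by
        filter_upwards [a.contMDiffAt.continuousAt.preimage_mem_nhds
          (extChartAt_source_mem_nhds (I := 𝓡 (n + 1)) x)] with s hs
        simp only [Function.comp_apply]
        rw [(extChartAt (𝓡 (n + 1)) x).left_inv hs]
      have eb : (e.chart ∘ (extChartAt (𝓡 (n + 1)) x).symm) ∘ (extChartAt (𝓡 (n + 1)) x ∘ b.sec)
          =ᶠ[𝓝 b.time] e.chart ∘ b.sec := by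
        rw [h2]
        filter_upwards [b.contMDiffAt.continuousAt.preimage_mem_nhds
          (extChartAt_source_mem_nhds (I := 𝓡 (n + 1)) (b.sec b.time))] with s hs
        simp only [Function.comp_apply]
        rw [(extChartAt (𝓡 (n + 1)) (b.sec b.time)).left_inv hs]
      rw [ea.iteratedDeriv_eq, h1, eb.iteratedDeriv_eq, ← h1] at this
      rw [← h1]; exact this
    rw [e.iteratedDeriv_comp a ha, e.iteratedDeriv_comp b hb] at key
    exact congrArg Prod.snd key
  · rintro ⟨h1, h3⟩
    have h4 : ∀ i ≤ k, iteratedDeriv i (e.chart ∘ a.sec) a.time =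
        iteratedDeriv i (e.chart ∘ b.sec) a.time := by
      intro i hi
      rw [e.iteratedDeriv_comp a ha, h1, e.iteratedDeriv_comp b hb]
      simp [liftCoord, h3 i hi]
    have h2 : a.sec a.time = b.sec b.time := by
      have := h4 0 (Nat.zero_le _)
      simp only [iteratedDeriv_zero, Function.comp_apply] at this
      rw [h1] at this ha
      rw [h1]
      exact e.chart.injOn ha hb this
    refine ⟨h1, h2, fun i hi => ?_⟩
    set x := a.sec a.time with hx
    rw [← h2, ← h1]
    have ca := e.contDiffAt_comp a ha
    have cb := e.contDiffAt_comp b hb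
    rw [← h1] at cb
    have := iteratedDeriv_comp_congr ca cb
        (F := extChartAt (𝓡 (n + 1)) x ∘ e.chart.symm) (e.contDiffAt_extChart ha) h4 hi
    have ea : (extChartAt (𝓡 (n + 1)) x ∘ e.chart.symm) ∘ (e.chart ∘ a.sec)
          =ᶠ[𝓝 a.time] extChartAt (𝓡 (n + 1)) x ∘ a.sec := by
      filter_upwards [e.eventually_mem a ha] with s hs
      simp only [Function.comp_apply]
      rw [e.chart.left_inv hs]
    have eb : (extChartAt (𝓡 (n + 1)) x ∘ e.chart.symm) ∘ (e.chart ∘ b.sec)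
          =ᶠ[𝓝 b.time] extChartAt (𝓡 (n + 1)) x ∘ b.sec := by
      filter_upwards [e.eventually_mem b hb] with s hs
      simp only [Function.comp_apply]
      rw [e.chart.left_inv hs]
    rw [ea.iteratedDeriv_eq, h1, eb.iteratedDeriv_eq, ← h1] at this
    exact this

theorem Jet.coord_mk (e : AdaptedChart P) (a : PointedSection P)
    (h : a.sec a.time ∈ e.chart.source) {i : ℕ} (hi : i ≤ k) :
    (Jet.mk k a).coord e i = a.coord e i := by
  have h1 : SameJet k (Jet.mk k a).rep a := Jet.mk_eq_mk.1 (Jet.mk_rep _)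
  refine ((sameJet_iff e _ _ ?_ h).1 h1).2 i hi
  rw [h1.2]; exact h

/-! ### The smooth structure of `J^k π` -/

/-- The polynomial curve with derivatives `Q i`, `i < N`, at `t`. -/
def taylorPoly (t : ℝ) (N : ℕ) (Q : ℕ → FibreModel n) (s : ℝ) : FibreModel n :=
  ∑ i ∈ Finset.range N, ((s - t) ^ i / (i.factorial : ℝ)) • Q i

theorem contDiff_taylorPoly (t : ℝ) (N : ℕ) (Q : ℕ → FibreModel n) :
    ContDiff ℝ ∞ (taylorPoly t N Q) := by
  unfold taylorPoly
  fun_prop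

theorem deriv_taylorPoly (t : ℝ) (N : ℕ) (Q : ℕ → FibreModel n) :
    deriv (taylorPoly t (N + 1) Q) = taylorPoly t N fun i => Q (i + 1) := by
  ext1 s
  refine HasDerivAt.deriv ?_
  have h : ∀ i ∈ Finset.range (N + 1), HasDerivAt
      (fun s => ((s - t) ^ i / (i.factorial : ℝ)) • Q i)
      (((i * (s - t) ^ (i - 1) * 1) / (i.factorial : ℝ)) • Q i) s := fun i _ =>
    ((((hasDerivAt_id s).sub_const t).pow i).div_const _).smul_const _
  have h2 := HasDerivAt.fun_sum h
  convert! h2 using 1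
  rw [Finset.sum_range_succ']
  simp only [taylorPoly, Nat.cast_zero, zero_mul, zero_div, zero_smul, add_zero]
  refine Finset.sum_congr rfl fun i _ => ?_
  congr 1
  have := Nat.factorial_ne_zero i
  rw [Nat.factorial_succ]
  push_cast
  field_simp

theorem iteratedDeriv_taylorPoly (t : ℝ) (m N : ℕ) (Q : ℕ → FibreModel n) :
    iteratedDeriv m (taylorPoly t N Q) t = if m < N then Q m else 0 := by
  induction m generalizing N Q with
  | zero =>
    cases N with
    | zero => simp [taylorPoly]
    | succ N => simp [taylorPoly, Finset.sum_range_succ']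
  | succ m ih =>
    rw [iteratedDeriv_succ']
    cases N with
    | zero =>
      have : taylorPoly t 0 Q = fun _ => 0 := by ext1 s; simp [taylorPoly]
      rw [this]; simp
    | succ N => rw [deriv_taylorPoly, ih]; simp

/-- The model space of `J^k π`, in which the coordinates `(t, q_0, …, q_k)` take their values. -/
abbrev JetModel (n k : ℕ) : Type := ℝ × (Fin (k + 1) → FibreModel n)

/-- Extension by zero of a tuple `(q_0, …, q_k)`. -/
def extendZero (q : Fin (k + 1) → FibreModel n) (i : ℕ) : FibreModel n :=
  if h : i < k + 1 then q ⟨i, h⟩ else 0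

theorem AdaptedChart.isLocalSection (e : AdaptedChart P) {q : ℝ → FibreModel n}
    (hq : ContDiff ℝ ∞ q) {t : ℝ} (h : (t, q t) ∈ e.chart.target) :
    IsLocalSection P (fun s => e.chart.symm (s, q s)) t := by
  have hc : ContDiff ℝ ∞ fun s : ℝ => (s, q s) := contDiff_id.prodMk hq
  filter_upwards [hc.continuous.continuousAt.preimage_mem_nhds
    (e.chart.open_target.mem_nhds h)] with s hs
  refine ⟨?_, ?_⟩
  · have h1 : ContMDiffAt 𝓘(ℝ, ℝ × FibreModel n) (𝓡 (n + 1)) ∞ e.chart.symm (s, q s) :=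
      e.contMDiffOn_symm.contMDiffAt (e.chart.open_target.mem_nhds hs)
    exact h1.comp s hc.contMDiff.contMDiffAt
  · rw [← e.fst_eq _ (e.chart.map_target hs), e.chart.right_inv hs]

theorem ConfigBundle.nonempty_pointedSection (P : ConfigBundle n E) :
    Nonempty (PointedSection P) := by
  obtain ⟨x, -⟩ := P.surjective 0
  have hx := mem_adaptedAt P x
  exact ⟨⟨_, _, (adaptedAt P x).isLocalSection (q := fun _ => ((adaptedAt P x).chart x).2)
    (t := ((adaptedAt P x).chart x).1) contDiff_const ((adaptedAt P x).chart.map_source hx)⟩⟩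

/-- The section with polynomial coordinates, in a given adapted chart, having the prescribed
jet coordinates. -/
def AdaptedChart.polySection (e : AdaptedChart P) (p : JetModel n k) (s : ℝ) : E :=
  e.chart.symm (s, taylorPoly p.1 (k + 1) (extendZero p.2) s)

theorem taylorPoly_self (p : JetModel n k) :
    taylorPoly p.1 (k + 1) (extendZero p.2) p.1 = p.2 0 := by
  have := iteratedDeriv_taylorPoly p.1 0 (k + 1) (extendZero p.2)
  simpa [extendZero] using this

theorem AdaptedChart.isLocalSection_polySection (e : AdaptedChart P) (p : JetModel n k)
    (hp : (p.1, p.2 0) ∈ e.chart.target) : IsLocalSection P (e.polySection p) p.1 :=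
  e.isLocalSection (contDiff_taylorPoly _ _ _) (by rwa [taylorPoly_self])

open Classical in
/-- The jet with prescribed coordinates in an adapted chart. -/
def AdaptedChart.ofCoord (e : AdaptedChart P) (p : JetModel n k) : Jet P k :=
  if h : (p.1, p.2 0) ∈ e.chart.target then
    Jet.mk k ⟨p.1, e.polySection p, e.isLocalSection_polySection p h⟩
  else Jet.mk k (Classical.choice P.nonempty_pointedSection)

theorem AdaptedChart.ofCoord_of_mem (e : AdaptedChart P) {p : JetModel n k}
    (h : (p.1, p.2 0) ∈ e.chart.target) : e.ofCoord p =
    Jet.mk k ⟨p.1, e.polySection p, e.isLocalSection_polySection p h⟩ := dif_pos h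

theorem AdaptedChart.polySection_self (e : AdaptedChart P) (p : JetModel n k) :
    e.polySection p p.1 = e.chart.symm (p.1, p.2 0) := by
  rw [AdaptedChart.polySection, taylorPoly_self]

theorem AdaptedChart.point_ofCoord (e : AdaptedChart P) {p : JetModel n k}
    (h : (p.1, p.2 0) ∈ e.chart.target) : (e.ofCoord p).point = e.chart.symm (p.1, p.2 0) := by
  rw [e.ofCoord_of_mem h, Jet.point_mk]
  exact e.polySection_self p

theorem AdaptedChart.polySection_eventuallyEq (e : AdaptedChart P) {p : JetModel n k}
    (h : (p.1, p.2 0) ∈ e.chart.target) : (fun s => e.chart (e.polySection p s)) =ᶠ[𝓝 p.1]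
      fun s => (s, taylorPoly p.1 (k + 1) (extendZero p.2) s) := by
  have hc : ContDiff ℝ ∞ fun s : ℝ => (s, taylorPoly p.1 (k + 1) (extendZero p.2) s) :=
    contDiff_id.prodMk (contDiff_taylorPoly _ _ _)
  filter_upwards [hc.continuous.continuousAt.preimage_mem_nhds
    (e.chart.open_target.mem_nhds (by rwa [taylorPoly_self]))] with s hs
  exact e.chart.right_inv hs

theorem AdaptedChart.coord_ofCoord (e : AdaptedChart P) {p : JetModel n k}
    (h : (p.1, p.2 0) ∈ e.chart.target) (i : Fin (k + 1)) :
    (e.ofCoord p).coord e i = p.2 i := by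
  rw [e.ofCoord_of_mem h, Jet.coord_mk]
  · simp only [PointedSection.coord]
    have h1 : (fun s => (e.chart (e.polySection p s)).2) =ᶠ[𝓝 p.1]
        taylorPoly p.1 (k + 1) (extendZero p.2) := by
      filter_upwards [e.polySection_eventuallyEq h] with s hs
      rw [hs]
    rw [h1.iteratedDeriv_eq, iteratedDeriv_taylorPoly, if_pos i.2, extendZero, dif_pos i.2]
  · simp only [e.polySection_self]
    exact e.chart.map_target h
  · exact Nat.lt_succ_iff.1 i.2

theorem AdaptedChart.coord_zero (e : AdaptedChart P) (j : Jet P k)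
    (hj : j.point ∈ e.chart.source) : e.chart j.point = (j.time, j.coord e 0) := by
  refine Prod.ext ?_ ?_
  · rw [e.fst_eq _ hj, j.proj_point]
  · simp [Jet.coord, PointedSection.coord, ← j.point_rep]

theorem AdaptedChart.ofCoord_coord (e : AdaptedChart P) (j : Jet P k)
    (hj : j.point ∈ e.chart.source) :
    e.ofCoord (k := k) (j.time, fun i => j.coord e i) = j := by
  have h : (j.time, j.coord e 0) ∈ e.chart.target := by
    rw [← e.coord_zero j hj]; exact e.chart.map_source hj
  set p : JetModel n k := (j.time, fun i => j.coord e i) with hp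
  have hpt : (e.ofCoord p).point ∈ e.chart.source := by
    rw [e.point_ofCoord h]; exact e.chart.map_target h
  rw [← (e.ofCoord p).mk_rep, ← j.mk_rep, Jet.mk_eq_mk, sameJet_iff e]
  · refine ⟨?_, fun i hi => ?_⟩
    · rw [Jet.time_rep, Jet.time_rep, e.ofCoord_of_mem h]; rfl
    · exact e.coord_ofCoord h ⟨i, Nat.lt_succ_iff.2 hi⟩
  · rwa [Jet.point_rep]
  · rwa [Jet.point_rep]

/-- The chart `(t, q_0, …, q_k)` of `J^k π` induced by an adapted chart `(t, q)` of `E`. -/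
def AdaptedChart.jetChart (e : AdaptedChart P) (k : ℕ) : PartialEquiv (Jet P k) (JetModel n k) where
  toFun j := (j.time, fun i => j.coord e i)
  invFun p := e.ofCoord p
  source := {j | j.point ∈ e.chart.source}
  target := {p | (p.1, p.2 0) ∈ e.chart.target}
  map_source' j hj := by
    have := e.chart.map_source hj
    rw [e.coord_zero j hj] at this
    exact this
  map_target' p hp := by
    simp only [mem_ofPred_eq]
    rw [e.point_ofCoord hp]
    exact e.chart.map_target hp
  left_inv' j hj := e.ofCoord_coord j hj
  right_inv' p hp := by
    refine Prod.ext ?_ ?_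
    · simp only; rw [e.ofCoord_of_mem hp]; rfl
    · ext1 i; exact e.coord_ofCoord hp i

theorem AdaptedChart.jetChart_trans_source (e e' : AdaptedChart P) :
    ((e.jetChart k).symm.trans (e'.jetChart k)).source =
      (fun p : JetModel n k => (p.1, p.2 0)) ⁻¹' (e.chart.symm.trans e'.chart).source := by
  ext p
  simp only [PartialEquiv.trans_source, OpenPartialHomeomorph.trans_source, mem_inter_iff,
    mem_preimage, PartialEquiv.symm_source, OpenPartialHomeomorph.symm_source]
  refine and_congr_right fun hp => ?_
  change (e.ofCoord p).point ∈ e'.chart.source ↔ _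
  rw [e.point_ofCoord hp]

theorem AdaptedChart.isOpen_jetChart_trans_source (e e' : AdaptedChart P) :
    IsOpen ((e.jetChart k).symm.trans (e'.jetChart k)).source := by
  rw [e.jetChart_trans_source e']
  exact (e.chart.symm.trans e'.chart).open_source.preimage (by fun_prop)

theorem AdaptedChart.contDiffOn_jetChart_trans (e e' : AdaptedChart P) :
    ContDiffOn ℝ ∞ ((e.jetChart k).symm.trans (e'.jetChart k))
      ((e.jetChart k).symm.trans (e'.jetChart k)).source := by
  rw [e.jetChart_trans_source e']
  let F : ℝ × FibreModel n → FibreModel n := fun z => (e'.chart (e.chart.symm z)).2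
  have hF : ∀ z ∈ (e.chart.symm.trans e'.chart).source, ContDiffAt ℝ ∞ F z := by
    intro z hz
    rw [OpenPartialHomeomorph.trans_source, OpenPartialHomeomorph.symm_source] at hz
    have h1 : ContMDiffAt 𝓘(ℝ, ℝ × FibreModel n) (𝓡 (n + 1)) ∞ e.chart.symm z :=
      e.contMDiffOn_symm.contMDiffAt (e.chart.open_target.mem_nhds hz.1)
    have h2 : ContMDiffAt (𝓡 (n + 1)) 𝓘(ℝ, ℝ × FibreModel n) ∞ e'.chart (e.chart.symm z) :=
      e'.contMDiffOn.contMDiffAt (e'.chart.open_source.mem_nhds hz.2)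
    exact _root_.contDiffAt_snd.comp z (contMDiffAt_iff_contDiffAt.1 (h2.comp z h1))
  let T : ℕ → JetModel n k → ℝ × FibreModel n := fun i p => liftCoord p.1 (extendZero p.2) i
  have hT : ∀ i, ContDiff ℝ ∞ (T i) := by
    intro i
    refine ContDiff.prodMk ?_ ?_
    · split_ifs
      · exact contDiff_fst
      · exact contDiff_const
      · exact contDiff_const
    · unfold extendZero
      split_ifs with h
      · exact (contDiff_apply ℝ (FibreModel n) (⟨i, h⟩ : Fin (k + 1))).comp contDiff_snd
      · exact contDiff_const
  have hL : ContDiff ℝ ∞ (fun p : JetModel n k => (p.1, p.2 0)) := by fun_prop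
  have main : ContDiffOn ℝ ∞ (fun p : JetModel n k => (p.1, fun m : Fin (k + 1) =>
      ∑ c : OrderedFinpartition (m : ℕ), iteratedFDeriv ℝ c.length F (p.1, p.2 0)
        fun l => T (c.partSize l) p))
      ((fun p : JetModel n k => (p.1, p.2 0)) ⁻¹' (e.chart.symm.trans e'.chart).source) := by
    intro p hp
    refine ContDiffAt.contDiffWithinAt (_root_.contDiffAt_fst.prodMk ?_)
    rw [contDiffAt_pi]
    intro m
    refine ContDiffAt.sum fun c _ => ?_
    have h1 : ContDiffAt ℝ ∞ (iteratedFDeriv ℝ c.length F) (p.1, p.2 0) :=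
      (hF _ hp).iteratedFDeriv_right (by exact_mod_cast le_top)
    have h2 : ContDiffAt ℝ ∞ (fun p : JetModel n k => iteratedFDeriv ℝ c.length F (p.1, p.2 0)) p :=
      h1.comp p hL.contDiffAt
    have h3 : ContDiffAt ℝ ∞ (fun (p : JetModel n k) (l : Fin c.length) => T (c.partSize l) p) p :=
      contDiffAt_pi.2 fun l => (hT _).contDiffAt
    have h4 := (ContinuousLinearMap.analyticAt_uncurry_of_multilinear
      (ContinuousLinearMap.id ℝ (ContinuousMultilinearMap ℝ
        (fun _ : Fin c.length => ℝ × FibreModel n) (FibreModel n)))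
      (x := (iteratedFDeriv ℝ c.length F (p.1, p.2 0), fun l => T (c.partSize l) p))).contDiffAt
      (n := ∞)
    exact h4.comp p (h2.prodMk h3)
  refine main.congr fun p hp => ?_
  have hp1 : (p.1, p.2 0) ∈ e.chart.target := by
    have := hp
    simp only [mem_preimage, OpenPartialHomeomorph.trans_source,
      OpenPartialHomeomorph.symm_source] at this
    exact this.1
  have hp2 : e.chart.symm (p.1, p.2 0) ∈ e'.chart.source := by
    have := hp
    simp only [mem_preimage, OpenPartialHomeomorph.trans_source,
      OpenPartialHomeomorph.symm_source] at this
    exact this.2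
  change ((e.ofCoord p).time, fun i : Fin (k + 1) => (e.ofCoord p).coord e' i) = _
  refine Prod.ext ?_ ?_
  · simp only; rw [e.ofCoord_of_mem hp1]; rfl
  · ext1 m
    simp only
    rw [e.ofCoord_of_mem hp1, Jet.coord_mk]
    · simp only [PointedSection.coord]
      have h0 := contDiff_taylorPoly p.1 (k + 1) (extendZero p.2)
      have hg : ContDiff ℝ ∞ fun s : ℝ => (s, taylorPoly p.1 (k + 1) (extendZero p.2) s) :=
        contDiff_id.prodMk h0
      have := iteratedDeriv_vcomp_eq_sum_orderedFinpartition (n := ∞) (i := m) (g := F)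
        (f := fun s : ℝ => (s, taylorPoly p.1 (k + 1) (extendZero p.2) s)) (x := p.1)
        (by rw [taylorPoly_self]; exact hF _ hp) hg.contDiffAt
        (by exact_mod_cast le_top)
      rw [taylorPoly_self] at this
      change iteratedDeriv m (F ∘ fun s : ℝ => (s, taylorPoly p.1 (k + 1) (extendZero p.2) s)) p.1
        = _
      rw [this]
      refine Finset.sum_congr rfl fun c _ => ?_
      congr 1
      ext1 l
      rw [iteratedDeriv_graph h0.contDiffAt]
      have hl : c.partSize l < k + 1 := lt_of_le_of_lt (c.partSize_le l) m.2
      simp only [T, liftCoord]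
      rw [iteratedDeriv_taylorPoly, if_pos hl]
    · simp only [e.polySection_self]
      exact hp2
    · exact Nat.lt_succ_iff.1 m.2

/-- The atlas of `J^k π` consisting of the charts induced by the adapted charts of `E`. -/
def jetCore (P : ConfigBundle n E) (k : ℕ) : ChartedSpaceCore (JetModel n k) (Jet P k) where
  atlas := range fun e : AdaptedChart P => e.jetChart k
  chartAt j := (adaptedAt P j.point).jetChart k
  mem_chart_source j := mem_adaptedAt P j.point
  chart_mem_atlas j := mem_range_self _
  open_source := by
    rintro _ _ ⟨e, rfl⟩ ⟨e', rfl⟩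
    exact e.isOpen_jetChart_trans_source e'
  continuousOn_toFun := by
    rintro _ _ ⟨e, rfl⟩ ⟨e', rfl⟩
    exact (e.contDiffOn_jetChart_trans e').continuousOn

instance (P : ConfigBundle n E) (k : ℕ) : TopologicalSpace (Jet P k) :=
  (jetCore P k).toTopologicalSpace

instance (P : ConfigBundle n E) (k : ℕ) : ChartedSpace (JetModel n k) (Jet P k) :=
  (jetCore P k).toChartedSpace

instance (P : ConfigBundle n E) (k : ℕ) : IsManifold 𝓘(ℝ, JetModel n k) ∞ (Jet P k) := by
  refine isManifold_of_contDiffOn _ _ _ ?_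
  intro c c' hc hc'
  change c ∈ ⋃ (e : PartialEquiv (Jet P k) (JetModel n k)) (he : e ∈ (jetCore P k).atlas),
    {(jetCore P k).openPartialHomeomorph e he} at hc
  change c' ∈ ⋃ (e : PartialEquiv (Jet P k) (JetModel n k)) (he : e ∈ (jetCore P k).atlas),
    {(jetCore P k).openPartialHomeomorph e he} at hc'
  simp only [mem_iUnion, mem_singleton_iff] at hc hc'
  obtain ⟨_, ⟨e, rfl⟩, rfl⟩ := hc
  obtain ⟨_, ⟨e', rfl⟩, rfl⟩ := hc'
  have := e.contDiffOn_jetChart_trans (k := k) e'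
  simp only [modelWithCornersSelf_coe, modelWithCornersSelf_coe_symm, range_id, inter_univ,
    Function.id_comp, Function.comp_id, preimage_id]
  exact this

namespace Jet

theorem extChartAt_apply (j j' : Jet P k) : extChartAt 𝓘(ℝ, JetModel n k) j j' =
    (j'.time, fun i : Fin (k + 1) => j'.coord (adaptedAt P j.point) i) := rfl

theorem extChartAt_symm_apply (j : Jet P k) (p : JetModel n k) :
    (extChartAt 𝓘(ℝ, JetModel n k) j).symm p = (adaptedAt P j.point).ofCoord p := rfl

theorem mem_chartAt_source (j j' : Jet P k) : j' ∈ (chartAt (JetModel n k) j).source ↔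
    j'.point ∈ (adaptedAt P j.point).chart.source := Iff.rfl

theorem contMDiff_time : ContMDiff 𝓘(ℝ, JetModel n k) 𝓘(ℝ, ℝ) ∞ (time : Jet P k → ℝ) := by
  intro j
  have h1 : ContMDiffAt 𝓘(ℝ, JetModel n k) 𝓘(ℝ, JetModel n k) ∞
      (extChartAt 𝓘(ℝ, JetModel n k) j) j := contMDiffAt_extChartAt
  exact (contDiff_fst (𝕜 := ℝ) (E := ℝ) (F := Fin (k + 1) → FibreModel n)).contMDiff.contMDiffAt.comp
    j h1

theorem contMDiff_projTo {r : ℕ} (h : r ≤ k) :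
    ContMDiff 𝓘(ℝ, JetModel n k) 𝓘(ℝ, JetModel n r) ∞
      (projTo r h : Jet P k → Jet P r) := by
  intro j
  have h1 : ContMDiffAt 𝓘(ℝ, JetModel n k) 𝓘(ℝ, JetModel n k) ∞
      (extChartAt 𝓘(ℝ, JetModel n k) j) j := contMDiffAt_extChartAt
  let T : JetModel n k → JetModel n r := fun p => (p.1, fun i => p.2 (Fin.castLE (by omega) i))
  have hT : ContDiff ℝ ∞ T := by fun_prop
  have hc : ∀ j' : Jet P k, j'.point ∈ (adaptedAt P j.point).chart.source →
      T (extChartAt 𝓘(ℝ, JetModel n k) j j') =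
        extChartAt 𝓘(ℝ, JetModel n r) (j.projTo r h) (j'.projTo r h) := by
    intro j' hj'
    rw [extChartAt_apply, extChartAt_apply, time_projTo, point_projTo]
    refine Prod.ext rfl ?_
    ext1 i
    simp only [T, Fin.val_castLE]
    have h3 := coord_mk (k := r) (adaptedAt P j.point) j'.rep (by rwa [point_rep])
      (Nat.lt_succ_iff.1 i.2)
    rw [← projTo_mk h, mk_rep] at h3
    exact h3.symm
  have h2 : ContMDiffAt 𝓘(ℝ, JetModel n r) 𝓘(ℝ, JetModel n r) ∞
      (extChartAt 𝓘(ℝ, JetModel n r) (j.projTo r h)).symm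
      (T (extChartAt 𝓘(ℝ, JetModel n k) j j)) := by
    rw [hc j (mem_adaptedAt P _)]
    exact (contMDiffOn_extChartAt_symm _).contMDiffAt (extChartAt_target_mem_nhds _)
  refine (h2.comp j (hT.contMDiff.contMDiffAt.comp j h1)).congr_of_eventuallyEq ?_
  filter_upwards [chart_source_mem_nhds (JetModel n k) j] with j' hj'
  simp only [Function.comp_apply]
  rw [hc j' hj', (extChartAt 𝓘(ℝ, JetModel n r) (j.projTo r h)).left_inv]
  rw [extChartAt_source, mem_chartAt_source, point_projTo, point_projTo]
  exact hj'

/-- The projection `π^k_r : J^k π → J^r π` as a smooth map. -/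
def projMap (P : ConfigBundle n E) (k r : ℕ) (h : r ≤ k) :
    C^∞⟮𝓘(ℝ, JetModel n k), Jet P k; 𝓘(ℝ, JetModel n r), Jet P r⟯ :=
  ⟨projTo r h, contMDiff_projTo h⟩

/-- The tangent spaces of `J^k π`. -/
abbrev Tangent (j : Jet P k) : Type := TangentSpace 𝓘(ℝ, JetModel n k) j

/-- The cotangent spaces `T*_j (J^k π)`. -/
abbrev Cotangent (j : Jet P k) : Type := TangentSpace 𝓘(ℝ, JetModel n k) j →L[ℝ] ℝ

/-- The `1`-form `dt = (π̄^k)^* η` on `J^k π`. -/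
def dt (j : Jet P k) : Cotangent j := mfderiv 𝓘(ℝ, JetModel n k) 𝓘(ℝ, ℝ) time j

end Jet

/-! ### The restricted cotangent bundle `T*(J^k π) / (π̄^k)^* T*ℝ` -/

namespace Jet

/-- The subspace `(π̄^k)^* T*ℝ` of `T*_j (J^k π)`, consisting of the pulled-back covectors
`β ∘ T_j π̄^k`, where `β` is a covector on the base `ℝ`. -/
def horizontalCovectors (j : Jet P k) : Submodule ℝ (Cotangent j) :=
  LinearMap.range ({
    toFun := fun β => β.comp (mfderiv 𝓘(ℝ, JetModel n k) 𝓘(ℝ, ℝ) time j)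
    map_add' := fun _ _ => ContinuousLinearMap.add_comp _ _ _
    map_smul' := fun _ _ => ContinuousLinearMap.smul_comp _ _ _ } :
      (TangentSpace 𝓘(ℝ, ℝ) j.time →L[ℝ] ℝ) →ₗ[ℝ] Cotangent j)

/-- The fibres of the quotient bundle `J^k π^* = T*(J^k π) / (π̄^k)^* T*ℝ`. -/
abbrev RestrictedCotangent (j : Jet P k) : Type := Cotangent j ⧸ horizontalCovectors j

theorem mem_horizontalCovectors {j : Jet P k} {α : Cotangent j} :
    α ∈ horizontalCovectors j ↔ ∃ c : ℝ, α = c • dt j := by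
  constructor
  · rintro ⟨β, rfl⟩
    refine ⟨(β : ℝ →L[ℝ] ℝ) 1, ?_⟩
    ext v
    change (β : ℝ →L[ℝ] ℝ) (dt j v) = (β : ℝ →L[ℝ] ℝ) 1 * (dt j v : ℝ)
    have : (β : ℝ →L[ℝ] ℝ) ((dt j v : ℝ) • (1 : ℝ)) = (dt j v : ℝ) • (β : ℝ →L[ℝ] ℝ) 1 :=
      (β : ℝ →L[ℝ] ℝ).map_smul _ _
    rw [smul_eq_mul, mul_one, smul_eq_mul, mul_comm] at this
    exact this
  · rintro ⟨c, rfl⟩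
    exact ⟨(c • ContinuousLinearMap.id ℝ ℝ : ℝ →L[ℝ] ℝ), by ext v; rfl⟩

/-- The model of the vertical directions `(q_0, …, q_k)`. -/
abbrev VertModel (n k : ℕ) : Type := Fin (k + 1) → FibreModel n

/-- The trivialization of the tangent bundle of `J^k π` induced by the chart at `j₀`. -/
abbrev tangentTriv (j₀ : Jet P k) :
    Trivialization (JetModel n k) (TotalSpace.proj : TangentBundle 𝓘(ℝ, JetModel n k) (Jet P k) → _) :=
  trivializationAt (JetModel n k) (TangentSpace 𝓘(ℝ, JetModel n k)) j₀

theorem fst_tangentTriv (j₀ : Jet P k) {j : Jet P k} (hj : j ∈ (tangentTriv j₀).baseSet) :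
    (ContinuousLinearMap.fst ℝ ℝ (VertModel n k)).comp
      ((tangentTriv j₀).continuousLinearMapAt ℝ j) = dt j := by
  have hj' : j ∈ (chartAt (JetModel n k) j₀).source := hj
  rw [TangentBundle.continuousLinearMapAt_trivializationAt hj', dt]
  have h1 : MDifferentiableAt 𝓘(ℝ, JetModel n k) 𝓘(ℝ, JetModel n k)
      (extChartAt 𝓘(ℝ, JetModel n k) j₀) j := mdifferentiableAt_extChartAt hj'
  have h2 : HasMFDerivAt 𝓘(ℝ, JetModel n k) 𝓘(ℝ, ℝ)
      (ContinuousLinearMap.fst ℝ ℝ (VertModel n k)) (extChartAt 𝓘(ℝ, JetModel n k) j₀ j)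
      (ContinuousLinearMap.fst ℝ ℝ (VertModel n k)) := ContinuousLinearMap.hasMFDerivAt _
  exact ((h2.comp j h1.hasMFDerivAt).mfderiv).symm

theorem dt_comp_symmL (j₀ : Jet P k) {j : Jet P k} (hj : j ∈ (tangentTriv j₀).baseSet) :
    (dt j).comp ((tangentTriv j₀).symmL ℝ j) = ContinuousLinearMap.fst ℝ ℝ (VertModel n k) := by
  rw [← fst_tangentTriv j₀ hj]
  refine ContinuousLinearMap.ext fun v => ?_
  simp only [ContinuousLinearMap.comp_apply]
  rw [Trivialization.continuousLinearMapAt_symmL _ hj]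

/-- Restriction of a covector to the vertical directions, in the chart at `j₀`. -/
def vertRestrict (j₀ j : Jet P k) : Cotangent j →L[ℝ] (VertModel n k →L[ℝ] ℝ) :=
  ContinuousLinearMap.precomp ℝ (((tangentTriv j₀).symmL ℝ j).comp
    (ContinuousLinearMap.inr ℝ ℝ (VertModel n k)))

theorem horizontalCovectors_le_ker (j₀ j : Jet P k) :
    horizontalCovectors j ≤ LinearMap.ker (vertRestrict j₀ j).toLinearMap := by
  intro α hα
  obtain ⟨c, rfl⟩ := mem_horizontalCovectors.1 hα
  rw [LinearMap.mem_ker]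
  ext1 v
  by_cases hj : j ∈ (tangentTriv j₀).baseSet
  · have := congrArg (fun f => f (0, v)) (dt_comp_symmL j₀ hj)
    simp only [ContinuousLinearMap.comp_apply, ContinuousLinearMap.coe_fst'] at this
    change c * (dt j) ((tangentTriv j₀).symmL ℝ j (0, v)) = 0
    rw [this, mul_zero]
  · change c * (dt j) ((tangentTriv j₀).symmL ℝ j (0, v)) = 0
    have : (tangentTriv j₀).symmL ℝ j (0, v) = 0 := by
      exact Trivialization.symmₗ_apply_of_notMem _ hj _
    rw [this, map_zero, mul_zero]

/-- The coordinates `p_A^i` of a class of covectors, in the chart at `j₀`. -/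
def restrictedCoord (j₀ j : Jet P k) : RestrictedCotangent j →ₗ[ℝ] (VertModel n k →L[ℝ] ℝ) :=
  (horizontalCovectors j).liftQ (vertRestrict j₀ j).toLinearMap (horizontalCovectors_le_ker j₀ j)

/-- The class of covectors with given coordinates `p_A^i`, in the chart at `j₀`. -/
def restrictedOfCoord (j₀ j : Jet P k) : (VertModel n k →L[ℝ] ℝ) →L[ℝ] Cotangent j :=
  ContinuousLinearMap.precomp ℝ ((ContinuousLinearMap.snd ℝ ℝ (VertModel n k)).comp
    ((tangentTriv j₀).continuousLinearMapAt ℝ j))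

theorem restrictedCoord_ofCoord (j₀ : Jet P k) {j : Jet P k}
    (hj : j ∈ (tangentTriv j₀).baseSet) (f : VertModel n k →L[ℝ] ℝ) :
    restrictedCoord j₀ j (Submodule.Quotient.mk (restrictedOfCoord j₀ j f)) = f := by
  ext1 v
  change f ((ContinuousLinearMap.snd ℝ ℝ (VertModel n k))
    ((tangentTriv j₀).continuousLinearMapAt ℝ j ((tangentTriv j₀).symmL ℝ j (0, v)))) = f v
  rw [Trivialization.continuousLinearMapAt_symmL _ hj]
  rfl

theorem ofCoord_restrictedCoord (j₀ : Jet P k) {j : Jet P k}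
    (hj : j ∈ (tangentTriv j₀).baseSet) (x : RestrictedCotangent j) :
    Submodule.Quotient.mk (restrictedOfCoord j₀ j (restrictedCoord j₀ j x)) = x := by
  induction x using Submodule.Quotient.induction_on with
  | _ α =>
    rw [Submodule.Quotient.eq, mem_horizontalCovectors]
    refine ⟨-α ((tangentTriv j₀).symmL ℝ j (1, 0)), ?_⟩
    ext1 v
    set w := (tangentTriv j₀).continuousLinearMapAt ℝ j v with hw
    have h1 : (dt j) v = w.1 := by rw [← fst_tangentTriv j₀ hj]; rfl
    have h2 : v = (tangentTriv j₀).symmL ℝ j w :=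
      (Trivialization.symmL_continuousLinearMapAt _ hj v).symm
    change α ((tangentTriv j₀).symmL ℝ j (0, w.2)) - α v =
      -α ((tangentTriv j₀).symmL ℝ j (1, 0)) * (dt j) v
    have h3 : α v = w.1 * α ((tangentTriv j₀).symmL ℝ j (1, 0)) +
        α ((tangentTriv j₀).symmL ℝ j (0, w.2)) := by
      conv_lhs => rw [h2]
      have : w = w.1 • ((1, 0) : JetModel n k) + (0, w.2) := by
        refine Prod.ext ?_ ?_ <;> simp
      conv_lhs => rw [this]
      rw [map_add, map_smul, map_add, map_smul, smul_eq_mul]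
    rw [h3, h1]
    ring

/-- The local trivialization, with coordinates `p_A^i`, of the restricted cotangent bundle over the
domain of the chart at `j₀`. -/
def restrictedPretriv (j₀ : Jet P k) :
    Pretrivialization (VertModel n k →L[ℝ] ℝ)
      (TotalSpace.proj : TotalSpace (VertModel n k →L[ℝ] ℝ)
        (fun j : Jet P k => RestrictedCotangent j) → Jet P k) where
  toFun x := (x.1, restrictedCoord j₀ x.1 x.2)
  invFun y := ⟨y.1, Submodule.Quotient.mk (restrictedOfCoord j₀ y.1 y.2)⟩
  source := TotalSpace.proj ⁻¹' (tangentTriv j₀).baseSet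
  target := (tangentTriv j₀).baseSet ×ˢ univ
  map_source' _ h := ⟨h, mem_univ _⟩
  map_target' _ h := h.1
  left_inv' := fun ⟨j, x⟩ h => by
    simp only
    rw [ofCoord_restrictedCoord j₀ h]
  right_inv' := fun ⟨j, f⟩ h => by
    simp only
    rw [restrictedCoord_ofCoord j₀ h.1]
  open_target := (tangentTriv j₀).open_baseSet.prod isOpen_univ
  baseSet := (tangentTriv j₀).baseSet
  open_baseSet := (tangentTriv j₀).open_baseSet
  source_eq := rfl
  target_eq := rfl
  proj_toFun _ _ := rfl

/-- The linear map by which a coordinate change of tangent vectors acts on the coordinates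
`p_A^i`: it sends `C` to the dual of `snd ∘ C ∘ inr`. -/
def vertDual (U : Type*) [NormedAddCommGroup U] [NormedSpace ℝ U] :
    (ℝ × U →L[ℝ] ℝ × U) →L[ℝ] ((U →L[ℝ] ℝ) →L[ℝ] (U →L[ℝ] ℝ)) :=
  (ContinuousLinearMap.compL ℝ U U ℝ).flip.comp
    ((ContinuousLinearMap.compL ℝ U (ℝ × U) U (ContinuousLinearMap.snd ℝ ℝ U)).comp
      ((ContinuousLinearMap.compL ℝ U (ℝ × U) (ℝ × U)).flip (ContinuousLinearMap.inr ℝ ℝ U)))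

theorem contMDiff_vertDual (U : Type*) [NormedAddCommGroup U] [NormedSpace ℝ U] :
    ContMDiff 𝓘(ℝ, ℝ × U →L[ℝ] ℝ × U) 𝓘(ℝ, (U →L[ℝ] ℝ) →L[ℝ] (U →L[ℝ] ℝ)) ∞ (vertDual U) :=
  ContinuousLinearMap.contMDiff _

theorem restrictedPretriv_coordChange (j₀ j₁ : Jet P k) :
    ContMDiffOn 𝓘(ℝ, JetModel n k)
        𝓘(ℝ, (VertModel n k →L[ℝ] ℝ) →L[ℝ] (VertModel n k →L[ℝ] ℝ)) ∞
        (fun j => vertDual (VertModel n k)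
          ((tangentTriv j₁).coordChangeL ℝ (tangentTriv j₀) j : JetModel n k →L[ℝ] JetModel n k))
        ((restrictedPretriv j₀).baseSet ∩ (restrictedPretriv j₁).baseSet) ∧
      ∀ j ∈ (restrictedPretriv j₀).baseSet ∩ (restrictedPretriv j₁).baseSet,
        ∀ f : VertModel n k →L[ℝ] ℝ, vertDual (VertModel n k)
          ((tangentTriv j₁).coordChangeL ℝ (tangentTriv j₀) j : JetModel n k →L[ℝ] JetModel n k) f =
          (restrictedPretriv j₁ ⟨j, (restrictedPretriv j₀).symm j f⟩).2 := by
  constructor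
  · have h := contMDiffOn_coordChangeL (IB := 𝓘(ℝ, JetModel n k)) (n := ∞)
      (tangentTriv j₁) (tangentTriv j₀)
    exact (contMDiff_vertDual (VertModel n k)).comp_contMDiffOn (h.mono fun j hj => ⟨hj.2, hj.1⟩)
  · intro j hj f
    rw [Pretrivialization.symm_apply _ hj.1]
    ext1 v
    change f (((tangentTriv j₁).coordChangeL ℝ (tangentTriv j₀) j (0, v)).2) =
      f (((tangentTriv j₀).continuousLinearMapAt ℝ j ((tangentTriv j₁).symmL ℝ j (0, v))).2)
    rw [Trivialization.coordChangeL_apply _ _ ⟨hj.2, hj.1⟩, Trivialization.symmL_apply,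
      Trivialization.continuousLinearMapAt_apply, Trivialization.coe_linearMapAt_of_mem _ hj.1]
    exact hj.2

/-- The vector bundle structure of `J^k π^* = T*(J^k π) / (π̄^k)^* T*ℝ`. -/
def restrictedPrebundle (P : ConfigBundle n E) (k : ℕ) :
    VectorPrebundle ℝ (VertModel n k →L[ℝ] ℝ) (fun j : Jet P k => RestrictedCotangent j) where
  pretrivializationAtlas := range restrictedPretriv
  pretrivialization_linear' := by
    rintro _ ⟨j₀, rfl⟩
    exact ⟨fun j _ => (restrictedCoord j₀ j).isLinear⟩
  pretrivializationAt := restrictedPretriv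
  mem_base_pretrivializationAt j := mem_baseSet_trivializationAt _ _ j
  pretrivialization_mem_atlas j := mem_range_self j
  exists_coordChange := by
    rintro _ ⟨j₀, rfl⟩ _ ⟨j₁, rfl⟩
    obtain ⟨h1, h2⟩ := restrictedPretriv_coordChange j₀ j₁
    exact ⟨_, h1.continuousOn, h2⟩
  totalSpaceMk_isInducing := by
    intro j
    have hj : j ∈ (tangentTriv j).baseSet := mem_baseSet_trivializationAt _ _ j
    let φ : RestrictedCotangent j ≃ₜ (VertModel n k →L[ℝ] ℝ) :=
      { toFun := restrictedCoord j j
        invFun := fun f => Submodule.Quotient.mk (restrictedOfCoord j j f)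
        left_inv := ofCoord_restrictedCoord j hj
        right_inv := restrictedCoord_ofCoord j hj
        continuous_toFun := by
          refine continuous_quot_lift _ ?_
          exact (vertRestrict j j).continuous
        continuous_invFun :=
          continuous_quot_mk.comp (restrictedOfCoord j j).continuous }
    exact isInducing_const_prod.mpr φ.isInducing

instance : TopologicalSpace (TotalSpace (VertModel n k →L[ℝ] ℝ)
    (fun j : Jet P k => RestrictedCotangent j)) := (restrictedPrebundle P k).totalSpaceTopology

instance : FiberBundle (VertModel n k →L[ℝ] ℝ) (fun j : Jet P k => RestrictedCotangent j) :=
  (restrictedPrebundle P k).toFiberBundle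

instance : VectorBundle ℝ (VertModel n k →L[ℝ] ℝ) (fun j : Jet P k => RestrictedCotangent j) :=
  (restrictedPrebundle P k).toVectorBundle

instance : (restrictedPrebundle P k).IsContMDiff 𝓘(ℝ, JetModel n k) ∞ where
  exists_contMDiffCoordChange := by
    rintro _ ⟨j₀, rfl⟩ _ ⟨j₁, rfl⟩
    exact ⟨_, restrictedPretriv_coordChange j₀ j₁⟩

instance : ContMDiffVectorBundle ∞ (VertModel n k →L[ℝ] ℝ)
    (fun j : Jet P k => RestrictedCotangent j) 𝓘(ℝ, JetModel n k) :=
  (restrictedPrebundle P k).contMDiffVectorBundle 𝓘(ℝ, JetModel n k)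

end Jet

/-! ### Lagrangian densities, the jet-momentum bundles and the Hamiltonian submanifold -/

namespace Jet

theorem prolong_time {r : ℕ} (h : r ≤ k) (j : Jet P k) : prolong r j.rep j.time = j.projTo r h := by
  rw [← time_rep, prolong, dif_pos j.rep.isLocalSection]
  conv_rhs => rw [← mk_rep j]
  rfl

/-- The differential `dq_i` at a point of `J^k π` of the coordinate `q_i` (`i ≤ k`) in an adapted
chart. -/
def dq (e : AdaptedChart P) (i : ℕ) (j : Jet P k) : Tangent j →L[ℝ] FibreModel n :=
  mfderiv 𝓘(ℝ, JetModel n k) 𝓘(ℝ, FibreModel n) (coord e i) j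

end Jet

/-- A `k`-th order Lagrangian density: a smooth `1`-form on `J^k π` which is `π̄^k`-semibasic, i.e.
vanishes on the `π̄^k`-vertical vectors. -/
structure LagrangianDensity (P : ConfigBundle n E) (k : ℕ) where
  form : ∀ j : Jet P k, Jet.Cotangent j
  smooth : ContMDiff 𝓘(ℝ, JetModel n k) (𝓘(ℝ, JetModel n k).prod 𝓘(ℝ, JetModel n k →L[ℝ] ℝ)) ∞
    fun j => (TotalSpace.mk' (JetModel n k →L[ℝ] ℝ) (E := fun j : Jet P k => Jet.Cotangent j)
      j (form j))
  semibasic : ∀ (j : Jet P k) (v : Jet.Tangent j), Jet.dt j v = 0 → form j v = 0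

/-- The projection `π^{2k-1}_{k-1} : J^{2k-1} π → J^{k-1} π`. -/
def baseMap (P : ConfigBundle n E) (k : ℕ) :
    C^∞⟮𝓘(ℝ, JetModel n (2 * k - 1)), Jet P (2 * k - 1); 𝓘(ℝ, JetModel n (k - 1)), Jet P (k - 1)⟯ :=
  Jet.projMap P (2 * k - 1) (k - 1) (by omega)

/-- The extended jet-momentum bundle `𝓦 = J^{2k-1} π ×_{J^{k-1} π} T*(J^{k-1} π)`: its points are
the pairs `⟨y, α⟩` with `y ∈ J^{2k-1} π` and `α` a covector of `J^{k-1} π` at the projection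
of `y`. -/
abbrev ExtendedBundle (P : ConfigBundle n E) (k : ℕ) : Type _ :=
  TotalSpace (JetModel n (k - 1) →L[ℝ] ℝ)
    (baseMap P k *ᵖ fun j : Jet P (k - 1) => Jet.Cotangent j)

/-- The restricted jet-momentum bundle `𝓦_r = J^{2k-1} π ×_{J^{k-1} π} J^{k-1} π^*`. -/
abbrev RestrictedBundle (P : ConfigBundle n E) (k : ℕ) : Type _ :=
  TotalSpace (Jet.VertModel n (k - 1) →L[ℝ] ℝ)
    (baseMap P k *ᵖ fun j : Jet P (k - 1) => Jet.RestrictedCotangent j)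

/-- The model of the manifold `𝓦`, with coordinates `(t, q_0, …, q_{2k-1}; p, p^0, …, p^{k-1})`. -/
abbrev extendedModel (n k : ℕ) :=
  𝓘(ℝ, JetModel n (2 * k - 1)).prod 𝓘(ℝ, JetModel n (k - 1) →L[ℝ] ℝ)

/-- The model of the manifold `𝓦_r`, with coordinates `(t, q_0, …, q_{2k-1}; p^0, …, p^{k-1})`. -/
abbrev restrictedModel (n k : ℕ) :=
  𝓘(ℝ, JetModel n (2 * k - 1)).prod 𝓘(ℝ, Jet.VertModel n (k - 1) →L[ℝ] ℝ)

/-- The projection `μ_𝓦 : 𝓦 → 𝓦_r`, `(y, α) ↦ (y, [α])`. -/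
def muW (w : ExtendedBundle P k) : RestrictedBundle P k :=
  ⟨w.1, (Submodule.Quotient.mk (w.2 : Jet.Cotangent (baseMap P k w.1)) :
    Jet.RestrictedCotangent (baseMap P k w.1))⟩

/-- The projection `ρ_ℝ : 𝓦 → ℝ`. -/
def rhoR (w : ExtendedBundle P k) : ℝ := w.1.time

/-- The coupling `1`-form `Ĉ` of `𝓦`: at `w = (y, α)` it is `α ∘ T_w (j^{k-1} φ ∘ ρ_ℝ)`, where `φ`
is a representative of `y`. (By `Jet.prolong_time` the map `j^{k-1} φ ∘ ρ_ℝ` sends `w` to the point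
`π^{2k-1}_{k-1} (y)` at which `α` is a covector; the value does not depend on `φ`, because the
derivative of `j^{k-1} φ` at the base instant is determined by the `k`-jet of `φ` there.) -/
def couplingForm (w : ExtendedBundle P k) : TangentSpace (extendedModel n k) w →L[ℝ] ℝ :=
  ContinuousLinearMap.comp (w.2 : Jet.Cotangent (baseMap P k w.1))
    (mfderiv (extendedModel n k) 𝓘(ℝ, JetModel n (k - 1))
      (fun w' : ExtendedBundle P k => Jet.prolong (k - 1) w.1.rep (rhoR w')) w)

/-- The pull-back `L̂ = (π^{2k-1}_k ∘ ρ_1)^* 𝓛` to `𝓦` of a Lagrangian density. -/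
def lagrangianForm (hk : 1 ≤ k) (L : LagrangianDensity P k) (w : ExtendedBundle P k) :
    TangentSpace (extendedModel n k) w →L[ℝ] ℝ :=
  (L.form (w.1.projTo k (by omega))).comp
    (mfderiv (extendedModel n k) 𝓘(ℝ, JetModel n k)
      (fun w' : ExtendedBundle P k => w'.1.projTo k (by omega)) w)

/-- The Hamiltonian submanifold `𝓦_o = {w ∈ 𝓦 | L̂(w) = Ĉ(w)}`. -/
def hamiltonianSubmanifold (hk : 1 ≤ k) (L : LagrangianDensity P k) : Set (ExtendedBundle P k) :=
  {w | lagrangianForm hk L w = couplingForm w}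

end Charts

end HighOrderMechanics

end

noncomputable section

set_option linter.unusedSectionVars false

namespace HighOrderMechanics

/-! ### Transport of a smooth structure along a homeomorphism -/

section Transport

variable {EN H V M N : Type*} [NormedAddCommGroup EN] [NormedSpace ℝ EN] [TopologicalSpace H]
  {J : ModelWithCorners ℝ EN H} [J.Boundaryless]
  [NormedAddCommGroup V] [NormedSpace ℝ V]
  [TopologicalSpace M] [TopologicalSpace N] [ChartedSpace H N]

/-! Let `T` be the velocity at the base instant of `j^{k-1} φ`, where `φ` represents `y`. In
coordinates `T = (1, q_1, …, q_k)`, so it depends smoothly on `y`, and `dt(T) = 1`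
(`dt_totalVector`, `continuousLinearMapAt_totalVector`). By the chain rule the coupling form at `w =
(y, α)` is `α(T)` times the differential of `ρ_ℝ`, and since `𝓛` is semibasic its pull-back is `L̂`
times the same differential (`couplingForm_apply`, `lagrangianForm_apply`). That differential never
vanishes, so the equation between 1-forms reduces to one scalar equation: `𝓦_o` is the zero set of
the defect `α(T) - L̂` (`mem_hamiltonianSubmanifold_iff`).

A fibre of `μ_𝓦` is a line `α + ℝ dt`, and along it the defect is affine with slope `dt(T) = 1`.
Hence `μ_𝓦` and the defect together form a bijection of `𝓦` with `𝓦_r × ℝ`, whose inverse sends `(y,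
[α], c)` to `α + (c + L̂ - α(T)) dt`. Both directions are smooth in coordinates, so this is a
diffeomorphism (`splitting`), and it carries `𝓦_o` to the slice `𝓦_r × {0}`.

Everything else follows from this slice picture. The smooth structure of `𝓦_o` is the one pulled
back from `𝓦_r` by `μ_𝓦 ∘ j_o`, which is thereby a diffeomorphism; the inclusion is an immersion
with complement `ℝ` because it is a slice in charts (`isImmersionOfComplement_of_diffeomorph`);
transversality holds because the composite of the differentials of `j_o` and `μ_𝓦` is bijective
(`isCompl_range_ker_mfderiv`); the section is the inverse of the splitting at `c = 0`. Its local
formula comes from evaluating `α = p dt + Σ p^i dq_i` on `T`, using `dq_i(T) = q_{i+1}`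
(`hamiltonian_eq`). -/

/-- The chart of `M` obtained from a chart of `N`, a homeomorphism `M ≃ₜ N` and a linear change of
the model space. -/
def transportChart (J : ModelWithCorners ℝ EN H) [J.Boundaryless] (Φ : M ≃ₜ N) (A : EN ≃L[ℝ] V)
    (c : OpenPartialHomeomorph N H) : OpenPartialHomeomorph M V :=
  (Φ.transOpenPartialHomeomorph c).transHomeomorph (J.toHomeomorph.trans A.toHomeomorph)

/-- The charted space structure transported along a homeomorphism. -/
@[reducible] def transportChartedSpace (J : ModelWithCorners ℝ EN H) [J.Boundaryless] (Φ : M ≃ₜ N)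
    (A : EN ≃L[ℝ] V) : ChartedSpace V M where
  atlas := transportChart J Φ A '' atlas H N
  chartAt x := transportChart J Φ A (chartAt H (Φ x))
  mem_chart_source x := by
    change Φ x ∈ (chartAt H (Φ x)).source
    exact mem_chart_source H (Φ x)
  chart_mem_atlas x := mem_image_of_mem _ (chart_mem_atlas H (Φ x))

theorem contMDiffOn_modelChart [IsManifold J ∞ N] (A : EN ≃L[ℝ] V) {c : OpenPartialHomeomorph N H}
    (hc : c ∈ atlas H N) : ContMDiffOn J 𝓘(ℝ, V) ∞ (fun z => A (J (c z))) c.source :=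
  (A.contDiff.contMDiff.comp J.contMDiff).comp_contMDiffOn
    (contMDiffOn_of_mem_maximalAtlas (IsManifold.subset_maximalAtlas hc))

theorem contMDiffOn_modelChart_symm [IsManifold J ∞ N] (A : EN ≃L[ℝ] V)
    {c : OpenPartialHomeomorph N H} (hc : c ∈ atlas H N) :
    ContMDiffOn 𝓘(ℝ, V) J ∞ (fun v => c.symm (J.symm (A.symm v)))
      ((fun v => J.symm (A.symm v)) ⁻¹' c.target) := by
  have h1 : ContMDiffOn 𝓘(ℝ, EN) J ∞ J.symm univ := by
    rw [← J.range_eq_univ]; exact J.contMDiffOn_symm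
  exact (contMDiffOn_symm_of_mem_maximalAtlas (IsManifold.subset_maximalAtlas hc)).comp
    (h1.comp A.symm.contDiff.contMDiff.contMDiffOn fun _ _ => mem_univ _) fun _ hv => hv

/-- In a change of charts the homeomorphism cancels against its inverse, leaving a coordinate change
of `N` conjugated by `A ∘ J`. -/
theorem isManifold_transport [IsManifold J ∞ N] (Φ : M ≃ₜ N) (A : EN ≃L[ℝ] V) :
    letI := transportChartedSpace J Φ A
    IsManifold 𝓘(ℝ, V) ∞ M := by
  let _ := transportChartedSpace J Φ A
  refine isManifold_of_contDiffOn _ _ _ ?_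
  rintro _ _ ⟨c, hc, rfl⟩ ⟨c', hc', rfl⟩
  rw [← contMDiffOn_iff_contDiffOn]
  have h := (contMDiffOn_modelChart (J := J) A hc').comp'
    (contMDiffOn_modelChart_symm (J := J) A hc)
  refine (h.mono ?_).congr ?_
  · rintro v ⟨⟨hv, hv'⟩, -⟩
    refine ⟨hv, ?_⟩
    change Φ (Φ.symm (c.symm (J.symm (A.symm v)))) ∈ c'.source at hv'
    rwa [Φ.apply_symm_apply] at hv'
  · intro v _
    change A (J (c' (Φ (Φ.symm (c.symm (J.symm (A.symm v))))))) = _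
    rw [Φ.apply_symm_apply]
    rfl

/-- A homeomorphism is a diffeomorphism for the transported smooth structure. -/
def transportDiffeomorph [IsManifold J ∞ N] (Φ : M ≃ₜ N) (A : EN ≃L[ℝ] V) :
    letI := transportChartedSpace J Φ A
    M ≃ₘ^∞⟮𝓘(ℝ, V), J⟯ N :=
  letI := transportChartedSpace J Φ A
  haveI := isManifold_transport (J := J) Φ A
  { toEquiv := Φ.toEquiv
    contMDiff_toFun := by
      intro x
      have h1 := contMDiffOn_chart (I := 𝓘(ℝ, V)) (n := ∞) (x := x)
      have h2 := (contMDiffOn_modelChart_symm (J := J) A (chart_mem_atlas H (Φ x))).comp' h1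
      have hs : (chartAt V x).source ∈ 𝓝 x := chart_source_mem_nhds V x
      refine (h2.congr_mono (f₁ := Φ) (s₁ := (chartAt V x).source) ?_ ?_).contMDiffAt hs
      -- Read in the transported chart and the chart it comes from, `Φ` is just the inverse of the
      -- change of model space.
      · intro y hy
        change Φ y = (chartAt H (Φ x)).symm (J.symm (A.symm (A (J (chartAt H (Φ x) (Φ y))))))
        rw [A.symm_apply_apply, J.left_inv]
        exact ((chartAt H (Φ x)).left_inv hy).symm
      · intro y hy
        exact ⟨hy, (chartAt V x).map_source hy⟩
    contMDiff_invFun := by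
      intro z
      have h1 := contMDiffOn_chart_symm (I := 𝓘(ℝ, V)) (n := ∞) (x := Φ.symm z)
      have h2 := h1.comp' (contMDiffOn_modelChart (J := J) A
        (chart_mem_atlas H (Φ (Φ.symm z))))
      -- The chart of `M` at `Φ.symm z` is built from the chart of `N` at `Φ (Φ.symm z)`, a point
      -- equal to `z` but not by definition.
      have hs : (chartAt H (Φ (Φ.symm z))).source ∈ 𝓝 z := by
        rw [show 𝓝 z = 𝓝 (Φ (Φ.symm z)) by rw [Φ.apply_symm_apply]]
        exact chart_source_mem_nhds H _
      have hl : ∀ y ∈ (chartAt H (Φ (Φ.symm z))).source,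
          J.symm (A.symm (A (J (chartAt H (Φ (Φ.symm z)) y)))) = chartAt H (Φ (Φ.symm z)) y := by
        intro y hy
        rw [A.symm_apply_apply, J.left_inv]
      refine (h2.congr_mono (f₁ := Φ.symm) (s₁ := (chartAt H (Φ (Φ.symm z))).source)
        ?_ ?_).contMDiffAt hs
      · intro y hy
        change Φ.symm y = Φ.symm ((chartAt H (Φ (Φ.symm z))).symm
          (J.symm (A.symm (A (J (chartAt H (Φ (Φ.symm z)) y))))))
        rw [hl y hy, (chartAt H (Φ (Φ.symm z))).left_inv hy]
      · intro y hy
        refine ⟨hy, ?_⟩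
        change J.symm (A.symm (A (J (chartAt H (Φ (Φ.symm z)) y)))) ∈
          (chartAt H (Φ (Φ.symm z))).target
        rw [hl y hy]
        exact (chartAt H (Φ (Φ.symm z))).map_source hy }

end Transport

/-! ### Immersions and diffeomorphisms -/

section Immersion

variable {EM EN EW F HM HN HW M N W : Type*}
  [NormedAddCommGroup EM] [NormedSpace ℝ EM] [NormedAddCommGroup EN] [NormedSpace ℝ EN]
  [NormedAddCommGroup EW] [NormedSpace ℝ EW] [NormedAddCommGroup F] [NormedSpace ℝ F]
  [TopologicalSpace HM] [TopologicalSpace HN] [TopologicalSpace HW]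
  {I : ModelWithCorners ℝ EM HM} {J : ModelWithCorners ℝ EN HN} {K : ModelWithCorners ℝ EW HW}
  [I.Boundaryless] [J.Boundaryless] [K.Boundaryless]
  [TopologicalSpace M] [ChartedSpace HM M] [IsManifold I ∞ M]
  [TopologicalSpace N] [ChartedSpace HN N] [IsManifold J ∞ N]
  [TopologicalSpace W] [ChartedSpace HW W] [IsManifold K ∞ W]

/-- A chart of `M` obtained from a chart of `N` by means of a diffeomorphism. -/
def diffeomorphChart (I : ModelWithCorners ℝ EM HM) (J : ModelWithCorners ℝ EN HN)
    [I.Boundaryless] [J.Boundaryless] (Φ : M ≃ₜ N) (A : EN ≃L[ℝ] EM)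
    (c : OpenPartialHomeomorph N HN) : OpenPartialHomeomorph M HM :=
  (transportChart J Φ A c).transHomeomorph I.toHomeomorph.symm

/-- The chart and its inverse are composites of smooth maps, which is all that membership in the
maximal atlas asks. Such charts put maps between manifolds into normal form. -/
theorem diffeomorphChart_mem_maximalAtlas (Φ : M ≃ₘ^∞⟮I, J⟯ N) (A : EN ≃L[ℝ] EM)
    {c : OpenPartialHomeomorph N HN} (hc : c ∈ atlas HN N) :
    diffeomorphChart I J Φ.toHomeomorph A c ∈ IsManifold.maximalAtlas I ∞ M := by
  have h0 : ContMDiff 𝓘(ℝ, EM) I ∞ I.symm := by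
    rw [← contMDiffOn_univ, ← I.range_eq_univ]; exact I.contMDiffOn_symm
  refine OpenPartialHomeomorph.mem_maximalAtlas_of_contMDiffOn _ ?_ ?_
  · exact h0.comp_contMDiffOn ((contMDiffOn_modelChart (J := J) A hc).comp
      Φ.contMDiff.contMDiffOn fun _ hx => hx)
  · exact Φ.symm.contMDiff.comp_contMDiffOn ((contMDiffOn_modelChart_symm (J := J) A hc).comp
      I.contMDiff.contMDiffOn fun _ hx => hx)

/-- Through `Φ` and `Ψ` the map is the slice `x ↦ (x, 0)`. In charts pulled back from `N` and from
`N × F` it becomes `v ↦ B (A⁻¹ v, 0)`, the normal form of an immersion. Any linear isomorphisms `A`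
and `B` of the models serve; no compatibility between them is needed. -/
theorem isImmersionOfComplement_of_diffeomorph (f : M → W) (Φ : M ≃ₘ^∞⟮I, J⟯ N)
    (Ψ : W ≃ₘ^∞⟮K, J.prod 𝓘(ℝ, F)⟯ (N × F)) (hf : ∀ x, Ψ (f x) = (Φ x, 0))
    (A : EN ≃L[ℝ] EM) (B : (EN × F) ≃L[ℝ] EW) : IsImmersionOfComplement F I K ∞ f := by
  intro x
  have hs : ∀ y, y ∈ (diffeomorphChart I J Φ.toHomeomorph A (chartAt HN (Φ x))).source →
      f y ∈ (diffeomorphChart K (J.prod 𝓘(ℝ, F)) Ψ.toHomeomorph B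
        (chartAt (ModelProd HN F) (Φ x, (0 : F)))).source := by
    intro y hy
    change Ψ (f y) ∈ (chartAt (ModelProd HN F) (Φ x, (0 : F))).source
    rw [hf, prodChartedSpace_chartAt]
    exact ⟨hy, mem_univ _⟩
  refine IsImmersionAtOfComplement.mk_of_charts
    ((A.symm.prodCongr (ContinuousLinearEquiv.refl ℝ F)).trans B)
    (diffeomorphChart I J Φ.toHomeomorph A (chartAt HN (Φ x)))
    (diffeomorphChart K (J.prod 𝓘(ℝ, F)) Ψ.toHomeomorph B
      (chartAt (ModelProd HN F) (Φ x, (0 : F)))) ?_ (hs x ?_)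
    (diffeomorphChart_mem_maximalAtlas Φ A (chart_mem_atlas _ _))
    (diffeomorphChart_mem_maximalAtlas Ψ B (chart_mem_atlas _ _)) hs ?_
  · exact mem_chart_source HN (Φ x)
  · exact mem_chart_source HN (Φ x)
  · intro v hv
    have hv1 : J.symm (A.symm v) ∈ (chartAt HN (Φ x)).target := by
      have := hv.2
      change J.symm (A.symm (I (I.symm v))) ∈ (chartAt HN (Φ x)).target at this
      rwa [I.right_inv (by simp [I.range_eq_univ])] at this
    change K (K.symm (B ((J.prod 𝓘(ℝ, F)) (chartAt (ModelProd HN F) (Φ x, (0 : F))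
      (Ψ (f (Φ.symm ((chartAt HN (Φ x)).symm (J.symm (A.symm (I (I.symm v)))))))))))) = _
    rw [K.right_inv (by simp [K.range_eq_univ]), I.right_inv (by simp [I.range_eq_univ]), hf,
      Φ.apply_symm_apply]
    change B (J (chartAt HN (Φ x) ((chartAt HN (Φ x)).symm (J.symm (A.symm v)))), 0) =
      B (A.symm v, 0)
    rw [(chartAt HN (Φ x)).right_inv hv1, J.right_inv (by simp [J.range_eq_univ])]

/-- Injectivity of the composite makes the intersection trivial. Surjectivity gives, for each `v`,
some `u` with `g (f u) = g v`, and then `v = f u + (v - f u)`. -/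
theorem isCompl_range_ker {U V W : Type*} [AddCommGroup U] [Module ℝ U] [AddCommGroup V]
    [Module ℝ V] [AddCommGroup W] [Module ℝ W] (f : U →ₗ[ℝ] V) (g : V →ₗ[ℝ] W)
    (h : Function.Bijective (g ∘ₗ f)) : IsCompl (LinearMap.range f) (LinearMap.ker g) := by
  refine IsCompl.of_eq ?_ ?_
  · rw [eq_bot_iff]
    rintro _ ⟨⟨u, rfl⟩, hu⟩
    have : u = 0 := h.1 (by rw [map_zero]; exact hu)
    rw [this, map_zero]; exact Submodule.zero_mem _
  · rw [eq_top_iff]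
    intro v _
    obtain ⟨u, hu⟩ := h.2 (g v)
    refine Submodule.mem_sup.2 ⟨f u, ⟨u, rfl⟩, v - f u, ?_, add_sub_cancel _ _⟩
    rw [LinearMap.mem_ker, map_sub, sub_eq_zero]
    exact hu.symm

/-- The differential of a diffeomorphism is bijective, and by the chain rule it is the composite of
the two differentials in question. -/
theorem isCompl_range_ker_mfderiv (Φ : M ≃ₘ^∞⟮I, J⟯ N) {f : M → W} {g : W → N}
    (h : ∀ x, Φ x = g (f x)) {x : M} (hf : MDifferentiableAt I K f x)
    (hg : MDifferentiableAt K J g (f x)) :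
    IsCompl (LinearMap.range (mfderiv I K f x).toLinearMap)
      (LinearMap.ker (mfderiv K J g (f x)).toLinearMap) := by
  refine isCompl_range_ker _ _ ?_
  have h1 := mfderiv_comp x hg hf
  rw [show g ∘ f = Φ from (funext h).symm] at h1
  have hb : Function.Bijective (mfderiv I J Φ x) :=
    (Φ.mfderivToContinuousLinearEquiv (by simp) x).bijective
  rw [h1] at hb
  exact hb

end Immersion

variable {n : ℕ} {E : Type*} [TopologicalSpace E]
  [ChartedSpace (EuclideanSpace ℝ (Fin (n + 1))) E]
  [IsManifold (𝓡 (n + 1)) ∞ E] {P : ConfigBundle n E} {k : ℕ}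

/-! ### Coordinates of jets and prolongations -/

/-- The chart of `J^k π` induced by an adapted chart, as an open partial homeomorphism. -/
def AdaptedChart.jetHomeomorph (e : AdaptedChart P) (k : ℕ) :
    OpenPartialHomeomorph (Jet P k) (JetModel n k) :=
  (jetCore P k).openPartialHomeomorph (e.jetChart k) (mem_range_self e)

/-- The atlas of `J^k π` contains the charts induced by all adapted charts, so coordinates may be
taken in any of them and not only in the chosen `adaptedAt`. -/
theorem AdaptedChart.jetHomeomorph_mem_maximalAtlas (e : AdaptedChart P) (k : ℕ) :
    e.jetHomeomorph k ∈ IsManifold.maximalAtlas 𝓘(ℝ, JetModel n k) ∞ (Jet P k) := by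
  refine IsManifold.subset_maximalAtlas ?_
  change _ ∈ ⋃ (e : PartialEquiv (Jet P k) (JetModel n k)) (he : e ∈ (jetCore P k).atlas),
    {(jetCore P k).openPartialHomeomorph e he}
  simp only [mem_iUnion, mem_singleton_iff]
  exact ⟨e.jetChart k, mem_range_self e, rfl⟩

theorem AdaptedChart.isOpen_point_mem (e : AdaptedChart P) (k : ℕ) :
    IsOpen {j : Jet P k | j.point ∈ e.chart.source} := (e.jetHomeomorph k).open_source

theorem Jet.contMDiffAt_coord (e : AdaptedChart P) {i : ℕ} (hi : i ≤ k) {j : Jet P k}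
    (hj : j.point ∈ e.chart.source) :
    ContMDiffAt 𝓘(ℝ, JetModel n k) 𝓘(ℝ, FibreModel n) ∞ (Jet.coord e i) j := by
  have h1 := (contMDiffOn_of_mem_maximalAtlas (e.jetHomeomorph_mem_maximalAtlas k)).contMDiffAt
    ((e.isOpen_point_mem k).mem_nhds hj)
  have h2 : ContDiff ℝ ∞ fun p : JetModel n k => p.2 ⟨i, Nat.lt_succ_of_le hi⟩ := by fun_prop
  exact h2.contMDiff.contMDiffAt.comp j h1

/-- Being a local section is an open condition on the instant, so the default branch of `prolong` is
never met near the base time. -/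
theorem Jet.prolong_eventually (a : PointedSection P) (k : ℕ) :
    ∀ᶠ s in 𝓝 a.time, ∃ h : IsLocalSection P a.sec s,
      Jet.prolong k a s = Jet.mk k ⟨s, a.sec, h⟩ := by
  filter_upwards [eventually_eventually_nhds.2 a.isLocalSection] with s hs
  exact ⟨hs, dif_pos hs⟩

theorem Jet.time_prolong_eventually (a : PointedSection P) (k : ℕ) :
    ∀ᶠ s in 𝓝 a.time, (Jet.prolong k a s).time = s := by
  filter_upwards [Jet.prolong_eventually a k] with s ⟨h, hs⟩
  rw [hs, Jet.time_mk]

theorem Jet.coord_prolong_eventually (e : AdaptedChart P) (a : PointedSection P)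
    (ha : a.sec a.time ∈ e.chart.source) {i : ℕ} (hi : i ≤ k) :
    ∀ᶠ s in 𝓝 a.time, (Jet.prolong k a s).coord e i =
      iteratedDeriv i (fun s => (e.chart (a.sec s)).2) s := by
  filter_upwards [Jet.prolong_eventually a k, e.eventually_mem a ha] with s ⟨h, hs⟩ hs'
  rw [hs, Jet.coord_mk e _ hs' hi]
  rfl

theorem AdaptedChart.contDiffAt_iteratedDeriv (e : AdaptedChart P) (a : PointedSection P)
    (ha : a.sec a.time ∈ e.chart.source) (i : ℕ) :
    ContDiffAt ℝ ∞ (iteratedDeriv i fun s => (e.chart (a.sec s)).2) a.time := by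
  have h := (e.contDiffAt_snd a ha).iteratedFDeriv_right (m := ∞) (i := i)
    (by exact_mod_cast le_top)
  have h2 : (iteratedDeriv i fun s => (e.chart (a.sec s)).2) = fun s =>
      ContinuousMultilinearMap.apply ℝ (fun _ : Fin i => ℝ) (FibreModel n) (fun _ => 1)
        (iteratedFDeriv ℝ i (fun s => (e.chart (a.sec s)).2) s) := rfl
  rw [h2]
  exact (ContinuousLinearMap.contDiff _).contDiffAt.comp _ h

/-- This is the origin of the index shift `q_i ↦ q_{i+1}` in the Hamiltonian. -/
theorem AdaptedChart.hasDerivAt_iteratedDeriv (e : AdaptedChart P) (a : PointedSection P)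
    (ha : a.sec a.time ∈ e.chart.source) (i : ℕ) :
    HasDerivAt (iteratedDeriv i fun s => (e.chart (a.sec s)).2) (a.coord e (i + 1)) a.time := by
  rw [PointedSection.coord, iteratedDeriv_succ]
  exact ((e.contDiffAt_iteratedDeriv a ha i).differentiableAt (by simp)).hasDerivAt

/-- In an induced chart the prolongation is the curve `s ↦ (s, q(s), q'(s), …)`. It is recovered
near the base time by composing this smooth curve with the inverse chart. -/
theorem Jet.contMDiffAt_prolong (a : PointedSection P) (k : ℕ) :
    ContMDiffAt 𝓘(ℝ, ℝ) 𝓘(ℝ, JetModel n k) ∞ (Jet.prolong k a) a.time := by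
  obtain ⟨e, ha⟩ := exists_adaptedChart P (a.sec a.time)
  let f : ℝ → JetModel n k := fun s =>
    (s, fun i => iteratedDeriv i (fun s => (e.chart (a.sec s)).2) s)
  have hf : ContDiffAt ℝ ∞ f a.time := contDiffAt_id.prodMk
    (contDiffAt_pi.2 fun i => e.contDiffAt_iteratedDeriv a ha i)
  have hm : f a.time ∈ (e.jetChart k).target := by
    have h := (e.jetChart k).map_source (x := Jet.mk k a) ha
    convert! h using 1
    refine Prod.ext rfl (funext fun i => ?_)
    exact (Jet.coord_mk e a ha (Nat.lt_succ_iff.1 i.2)).symm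
  have h2 := (contMDiffOn_symm_of_mem_maximalAtlas
    (e.jetHomeomorph_mem_maximalAtlas k)).contMDiffAt
      ((e.jetHomeomorph k).open_target.mem_nhds hm)
  refine (h2.comp a.time hf.contMDiffAt).congr_of_eventuallyEq ?_
  have h3 : ∀ᶠ s in 𝓝 a.time, ∀ i : Fin (k + 1), (Jet.prolong k a s).coord e i =
      iteratedDeriv i (fun s => (e.chart (a.sec s)).2) s :=
    eventually_all.2 fun i => Jet.coord_prolong_eventually e a ha (Nat.lt_succ_iff.1 i.2)
  filter_upwards [h3, Jet.prolong_eventually a k, e.eventually_mem a ha] with s h3 ⟨h, hs⟩ hs'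
  have h4 : (Jet.prolong k a s).point ∈ e.chart.source := by rw [hs]; exact hs'
  refine ((e.jetChart k).left_inv h4).symm.trans ?_
  change e.ofCoord _ = e.ofCoord _
  congr 1
  refine Prod.ext ?_ (funext h3)
  change (Jet.prolong k a s).time = s
  rw [hs]; rfl

/-! ### The total derivative along a jet -/

/-- The tangent vector at `π^{2k-1}_{k-1} (y)` of the prolongation `j^{k-1} φ` of a section
representing `y`. -/
def totalVector (y : Jet P (2 * k - 1)) : Jet.Tangent (baseMap P k y) :=
  (mfderiv 𝓘(ℝ, ℝ) 𝓘(ℝ, JetModel n (k - 1)) (Jet.prolong (k - 1) y.rep) y.time : _ →L[ℝ] _)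
    (1 : ℝ)

theorem prolong_rep_time (y : Jet P (2 * k - 1)) :
    Jet.prolong (k - 1) y.rep y.time = baseMap P k y := Jet.prolong_time (by omega) y

theorem mdifferentiableAt_prolong_rep (y : Jet P (2 * k - 1)) :
    MDifferentiableAt 𝓘(ℝ, ℝ) 𝓘(ℝ, JetModel n (k - 1)) (Jet.prolong (k - 1) y.rep) y.time := by
  rw [← y.time_rep]
  exact (Jet.contMDiffAt_prolong y.rep (k - 1)).mdifferentiableAt (by simp)

/-- Chain rule: differentiating along the total vector is ordinary differentiation along the
prolonged section, for which only the germ at the base instant matters. The values of `dt`, of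
`dq_i` and of the whole chart on the total vector are all instances. -/
theorem mfderiv_totalVector {G : Type*} [NormedAddCommGroup G] [NormedSpace ℝ G]
    (y : Jet P (2 * k - 1)) {f : Jet P (k - 1) → G} {g : ℝ → G} {g' : G}
    (hf : MDifferentiableAt 𝓘(ℝ, JetModel n (k - 1)) 𝓘(ℝ, G) f (baseMap P k y))
    (hfg : ∀ᶠ s in 𝓝 y.time, f (Jet.prolong (k - 1) y.rep s) = g s)
    (hg : HasDerivAt g g' y.time) :
    mfderiv 𝓘(ℝ, JetModel n (k - 1)) 𝓘(ℝ, G) f (baseMap P k y) (totalVector y) = g' := by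
  rw [← prolong_rep_time] at hf
  have h1 := mfderiv_comp (x := y.time) hf (mdifferentiableAt_prolong_rep y)
  have h2 : mfderiv 𝓘(ℝ, ℝ) 𝓘(ℝ, G) (f ∘ Jet.prolong (k - 1) y.rep) y.time =
      mfderiv 𝓘(ℝ, ℝ) 𝓘(ℝ, G) g y.time := Filter.EventuallyEq.mfderiv_eq hfg
  rw [h2, mfderiv_eq_fderiv, hg.hasFDerivAt.fderiv] at h1
  have h3 := DFunLike.congr_fun h1 (1 : ℝ)
  rw [prolong_rep_time] at h3
  refine h3.symm.trans ?_
  exact one_smul ℝ g'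

/-- A prolongation is a section over time. This normalization makes the coupling defect affine with
slope one along the fibres of `μ_𝓦`. -/
theorem dt_totalVector (y : Jet P (2 * k - 1)) :
    Jet.dt (baseMap P k y) (totalVector y) = (1 : ℝ) := by
  refine mfderiv_totalVector y (Jet.contMDiff_time.contMDiffAt.mdifferentiableAt (by simp))
    ?_ (hasDerivAt_id y.time)
  have := Jet.time_prolong_eventually y.rep (k - 1)
  rw [y.time_rep] at this
  exact this

theorem coord_prolong_rep_eventually (e : AdaptedChart P) (y : Jet P (2 * k - 1))
    (hy : y.point ∈ e.chart.source) {i : ℕ} (hi : i ≤ k - 1) :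
    ∀ᶠ s in 𝓝 y.time, (Jet.prolong (k - 1) y.rep s).coord e i =
      iteratedDeriv i (fun s => (e.chart (y.rep.sec s)).2) s := by
  have := Jet.coord_prolong_eventually e y.rep (by rwa [y.point_rep]) hi
  rwa [y.time_rep] at this

theorem hasDerivAt_iteratedDeriv_rep (e : AdaptedChart P) (y : Jet P (2 * k - 1))
    (hy : y.point ∈ e.chart.source) (i : ℕ) :
    HasDerivAt (iteratedDeriv i fun s => (e.chart (y.rep.sec s)).2) (y.coord e (i + 1))
      y.time := by
  have := e.hasDerivAt_iteratedDeriv y.rep (by rwa [y.point_rep]) i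
  rwa [y.time_rep] at this

theorem point_baseMap (y : Jet P (2 * k - 1)) : (baseMap P k y).point = y.point :=
  Jet.point_projTo (by omega) y

theorem dq_totalVector (e : AdaptedChart P) (y : Jet P (2 * k - 1))
    (hy : y.point ∈ e.chart.source) {i : ℕ} (hi : i ≤ k - 1) :
    Jet.dq e i (baseMap P k y) (totalVector y) = y.coord e (i + 1) :=
  mfderiv_totalVector y
    ((Jet.contMDiffAt_coord e hi (by rwa [point_baseMap])).mdifferentiableAt (by simp))
    (coord_prolong_rep_eventually e y hy hi) (hasDerivAt_iteratedDeriv_rep e y hy i)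

/-- The coordinates `(q_1, …, q_k)` of the total vector in an adapted chart. -/
def shiftCoord (e : AdaptedChart P) (y : Jet P (2 * k - 1)) : Jet.VertModel n (k - 1) :=
  fun i => y.coord e (i + 1)

theorem contMDiffAt_shiftCoord (hk : 1 ≤ k) (e : AdaptedChart P) {y : Jet P (2 * k - 1)}
    (hy : y.point ∈ e.chart.source) :
    ContMDiffAt 𝓘(ℝ, JetModel n (2 * k - 1)) 𝓘(ℝ, Jet.VertModel n (k - 1)) ∞
      (shiftCoord e) y :=
  -- The indices reach `k`, and `k ≤ 2k - 1` is where `1 ≤ k` enters.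
  contMDiffAt_pi_space.2 fun i => Jet.contMDiffAt_coord e (by omega) hy

theorem mem_tangentTriv_baseSet {j₀ j : Jet P k} :
    j ∈ (Jet.tangentTriv j₀).baseSet ↔ j.point ∈ (adaptedAt P j₀.point).chart.source := Iff.rfl

/-- The tangent trivialization is the differential of the chart, so it can be evaluated along the
prolongation. The result shows that the total vector varies smoothly with `y`, although it was
defined by an arbitrary choice of representative. -/
theorem continuousLinearMapAt_totalVector (j₀ : Jet P (k - 1)) (y : Jet P (2 * k - 1))
    (hy : baseMap P k y ∈ (Jet.tangentTriv j₀).baseSet) :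
    (Jet.tangentTriv j₀).continuousLinearMapAt ℝ (baseMap P k y) (totalVector y) =
      (1, shiftCoord (adaptedAt P j₀.point) y) := by
  have hy' : y.point ∈ (adaptedAt P j₀.point).chart.source := by
    rwa [mem_tangentTriv_baseSet, point_baseMap] at hy
  rw [TangentBundle.continuousLinearMapAt_trivializationAt hy]
  refine mfderiv_totalVector y (mdifferentiableAt_extChartAt hy)
    (g := fun s => (s, fun i : Fin (k - 1 + 1) =>
      iteratedDeriv i (fun s => ((adaptedAt P j₀.point).chart (y.rep.sec s)).2) s)) ?_ ?_
  · have h3 : ∀ᶠ s in 𝓝 y.time, ∀ i : Fin (k - 1 + 1),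
        (Jet.prolong (k - 1) y.rep s).coord (adaptedAt P j₀.point) i =
          iteratedDeriv i (fun s => ((adaptedAt P j₀.point).chart (y.rep.sec s)).2) s :=
      eventually_all.2 fun i => coord_prolong_rep_eventually _ y hy' (Nat.lt_succ_iff.1 i.2)
    have h4 := Jet.time_prolong_eventually y.rep (k - 1)
    rw [y.time_rep] at h4
    filter_upwards [h3, h4] with s h3 h4
    rw [Jet.extChartAt_apply]
    exact Prod.ext h4 (funext h3)
  · exact (hasDerivAt_id y.time).prodMk
      (hasDerivAt_pi.2 fun i => hasDerivAt_iteratedDeriv_rep _ y hy' i)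

theorem totalVector_eq_symmL (j₀ : Jet P (k - 1)) (y : Jet P (2 * k - 1))
    (hy : baseMap P k y ∈ (Jet.tangentTriv j₀).baseSet) :
    totalVector y = (Jet.tangentTriv j₀).symmL ℝ (baseMap P k y)
      (1, shiftCoord (adaptedAt P j₀.point) y) := by
  rw [← continuousLinearMapAt_totalVector j₀ y hy]
  exact (Trivialization.symmL_continuousLinearMapAt _ hy _).symm

/-- The covector `α` of a point `(y, α)` of `𝓦`. -/
def covector (w : ExtendedBundle P k) : Jet.Cotangent (baseMap P k w.1) := w.2

/-- The differential of `ρ_ℝ` at a point of `𝓦`, as a covector. -/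
def rhoRDiff (w : ExtendedBundle P k) : TangentSpace (extendedModel n k) w →L[ℝ] ℝ :=
  mfderiv (extendedModel n k) 𝓘(ℝ, ℝ) (rhoR : ExtendedBundle P k → ℝ) w

/-! ### Fibre coordinates of the jet-momentum bundles -/

/-- The trivialization is pulled back from a bundle of linear maps into a trivial line, so only the
source side contributes. The resulting functional on the model has components `(p, p^0, …,
p^{k-1})`. -/
theorem trivializationAt_extended (y₀ : Jet P (2 * k - 1)) (w : ExtendedBundle P k) :
    (trivializationAt (JetModel n (k - 1) →L[ℝ] ℝ)
      (baseMap P k *ᵖ fun j : Jet P (k - 1) => Jet.Cotangent j) y₀ w).2 =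
      (covector w).comp
        ((Jet.tangentTriv (baseMap P k y₀)).symmL ℝ (baseMap P k w.1)) := by
  change (trivializationAt (JetModel n (k - 1) →L[ℝ] ℝ)
    (fun j : Jet P (k - 1) => Jet.Cotangent j) (baseMap P k y₀)
      ⟨baseMap P k w.1, covector w⟩).2 = _
  rw [hom_trivializationAt_apply]
  refine ContinuousLinearMap.ext fun v => ?_
  simp [ContinuousLinearMap.inCoordinates]

theorem contMDiff_extended_proj :
    ContMDiff (extendedModel n k) 𝓘(ℝ, JetModel n (2 * k - 1)) ∞
      (fun w : ExtendedBundle P k => w.1) :=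
  contMDiff_proj (baseMap P k *ᵖ fun j : Jet P (k - 1) => Jet.Cotangent j)

theorem contMDiff_restricted_proj :
    ContMDiff (restrictedModel n k) 𝓘(ℝ, JetModel n (2 * k - 1)) ∞
      (fun z : RestrictedBundle P k => z.1) :=
  contMDiff_proj (baseMap P k *ᵖ fun j : Jet P (k - 1) => Jet.RestrictedCotangent j)

theorem contMDiffAt_extended_iff {EM HM M : Type*} [NormedAddCommGroup EM] [NormedSpace ℝ EM]
    [TopologicalSpace HM] {I : ModelWithCorners ℝ EM HM} [TopologicalSpace M] [ChartedSpace HM M]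
    {f : M → ExtendedBundle P k} {x : M} :
    ContMDiffAt I (extendedModel n k) ∞ f x ↔
      ContMDiffAt I 𝓘(ℝ, JetModel n (2 * k - 1)) ∞ (fun x => (f x).1) x ∧
      ContMDiffAt I 𝓘(ℝ, JetModel n (k - 1) →L[ℝ] ℝ) ∞ (fun x' =>
        (covector (f x')).comp
          ((Jet.tangentTriv (baseMap P k (f x).1)).symmL ℝ (baseMap P k (f x').1))) x := by
  refine contMDiffAt_totalSpace.trans (and_congr Iff.rfl ?_)
  simp only [trivializationAt_extended]

theorem contMDiffAt_restricted_iff {EM HM M : Type*} [NormedAddCommGroup EM] [NormedSpace ℝ EM]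
    [TopologicalSpace HM] {I : ModelWithCorners ℝ EM HM} [TopologicalSpace M] [ChartedSpace HM M]
    {f : M → RestrictedBundle P k} {x : M} :
    ContMDiffAt I (restrictedModel n k) ∞ f x ↔
      ContMDiffAt I 𝓘(ℝ, JetModel n (2 * k - 1)) ∞ (fun x => (f x).1) x ∧
      ContMDiffAt I 𝓘(ℝ, Jet.VertModel n (k - 1) →L[ℝ] ℝ) ∞ (fun x' =>
        Jet.restrictedCoord (baseMap P k (f x).1) (baseMap P k (f x').1) (f x').2) x :=
  contMDiffAt_totalSpace

theorem contMDiffAt_extended_coord (w : ExtendedBundle P k) :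
    ContMDiffAt (extendedModel n k) 𝓘(ℝ, JetModel n (k - 1) →L[ℝ] ℝ) ∞
      (fun w' : ExtendedBundle P k => (covector w').comp
        ((Jet.tangentTriv (baseMap P k w.1)).symmL ℝ (baseMap P k w'.1))) w :=
  (contMDiffAt_extended_iff.1 contMDiffAt_id).2

theorem contMDiffAt_restricted_coord (z : RestrictedBundle P k) :
    ContMDiffAt (restrictedModel n k) 𝓘(ℝ, Jet.VertModel n (k - 1) →L[ℝ] ℝ) ∞
      (fun z' : RestrictedBundle P k =>
        Jet.restrictedCoord (baseMap P k z.1) (baseMap P k z'.1) z'.2) z :=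
  (contMDiffAt_restricted_iff.1 contMDiffAt_id).2

/-- In fibre coordinates `μ_𝓦` drops `p`: it restricts a functional on `ℝ × U` to the vertical
factor `U`. -/
theorem contMDiff_muW :
    ContMDiff (extendedModel n k) (restrictedModel n k) ∞
      (muW : ExtendedBundle P k → RestrictedBundle P k) := by
  intro w
  refine contMDiffAt_restricted_iff.2 ⟨contMDiff_extended_proj w, ?_⟩
  let R : (JetModel n (k - 1) →L[ℝ] ℝ) →L[ℝ] (Jet.VertModel n (k - 1) →L[ℝ] ℝ) :=
    ContinuousLinearMap.precomp ℝ (ContinuousLinearMap.inr ℝ ℝ (Jet.VertModel n (k - 1)))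
  exact R.contDiff.contMDiff.contMDiffAt.comp w (contMDiffAt_extended_coord w)

theorem contMDiff_rhoR :
    ContMDiff (extendedModel n k) 𝓘(ℝ, ℝ) ∞ (rhoR : ExtendedBundle P k → ℝ) :=
  Jet.contMDiff_time.comp contMDiff_extended_proj

theorem baseMap_mem_baseSet (y : Jet P (2 * k - 1)) :
    baseMap P k y ∈ (Jet.tangentTriv (baseMap P k y)).baseSet :=
  mem_baseSet_trivializationAt _ _ _

theorem eventually_baseMap_mem (y : Jet P (2 * k - 1)) : ∀ᶠ y' in 𝓝 y,
    baseMap P k y' ∈ (Jet.tangentTriv (baseMap P k y)).baseSet :=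
  (baseMap P k).contMDiff.continuous.continuousAt.preimage_mem_nhds
    ((Jet.tangentTriv (baseMap P k y)).open_baseSet.mem_nhds (baseMap_mem_baseSet y))

/-! ### The Lagrangian function -/

/-- The function `L` with `𝓛 = L dt`. -/
def LagrangianDensity.toFun (L : LagrangianDensity P k) (j : Jet P k) : ℝ :=
  L.form j ((Jet.tangentTriv j).symmL ℝ j ((1, 0) : JetModel n k))

theorem Jet.dt_symmL (j₀ : Jet P k) {j : Jet P k} (hj : j ∈ (Jet.tangentTriv j₀).baseSet)
    (v : JetModel n k) : Jet.dt j ((Jet.tangentTriv j₀).symmL ℝ j v) = v.1 :=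
  DFunLike.congr_fun (Jet.dt_comp_symmL j₀ hj) v

/-- Subtracting `c` times a vector on which `dt` is `1` leaves a vertical vector, which a semibasic
form kills. Thus `𝓛 = L dt`. -/
theorem LagrangianDensity.form_apply (L : LagrangianDensity P k) (j : Jet P k)
    {u : Jet.Tangent j} {c : ℝ} (hu : Jet.dt j u = c) : L.form j u = c * L.toFun j := by
  set X : Jet.Tangent j := (Jet.tangentTriv j).symmL ℝ j ((1, 0) : JetModel n k) with hX
  have hX1 : Jet.dt j X = (1 : ℝ) := Jet.dt_symmL j (mem_baseSet_trivializationAt _ _ _) _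
  have h : Jet.dt j (u - c • X) = 0 := by
    rw [map_sub, map_smul, hX1, hu, smul_eq_mul, mul_one, sub_self]
  have h2 := L.semibasic j _ h
  rw [map_sub, map_smul, sub_eq_zero] at h2
  exact h2

theorem LagrangianDensity.contMDiff_toFun (L : LagrangianDensity P k) :
    ContMDiff 𝓘(ℝ, JetModel n k) 𝓘(ℝ, ℝ) ∞ L.toFun := by
  intro j
  have h1 := ((contMDiffAt_hom_bundle _).1 (L.smooth j)).2
  let R : (JetModel n k →L[ℝ] ℝ) →L[ℝ] ℝ :=
    ContinuousLinearMap.apply ℝ ℝ ((1, 0) : JetModel n k)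
  refine (R.contDiff.contMDiff.contMDiffAt.comp j h1).congr_of_eventuallyEq ?_
  filter_upwards [(Jet.tangentTriv j).open_baseSet.mem_nhds
    (mem_baseSet_trivializationAt _ _ _)] with j' hj'
  -- `toFun` evaluates on the unit time vector of the chart at the moving point `j'`; by
  -- `form_apply` the one of the fixed chart at `j` gives the same value.
  have h2 := L.form_apply j' (Jet.dt_symmL j hj' ((1, 0) : JetModel n k))
  simp only [one_mul] at h2
  rw [← h2]
  simp [ContinuousLinearMap.inCoordinates, R]

/-- The function `⟨α, T⟩ - L̂`, where `T` is the total vector, whose zeros form the Hamiltonian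
submanifold. -/
def couplingDefect (L : LagrangianDensity P k) (hk : 1 ≤ k) (w : ExtendedBundle P k) : ℝ :=
  covector w (totalVector w.1) -
    L.toFun (w.1.projTo k (by omega))

theorem contMDiff_lagrangian (L : LagrangianDensity P k) (hk : 1 ≤ k) :
    ContMDiff 𝓘(ℝ, JetModel n (2 * k - 1)) 𝓘(ℝ, ℝ) ∞
      (fun y : Jet P (2 * k - 1) => L.toFun (y.projTo k (by omega))) :=
  L.contMDiff_toFun.comp (Jet.contMDiff_projTo (by omega))

theorem contMDiffAt_shiftCoord_base (hk : 1 ≤ k) (y : Jet P (2 * k - 1)) :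
    ContMDiffAt 𝓘(ℝ, JetModel n (2 * k - 1)) 𝓘(ℝ, Jet.VertModel n (k - 1)) ∞
      (shiftCoord (adaptedAt P (baseMap P k y).point)) y :=
  contMDiffAt_shiftCoord hk _ (by rw [← point_baseMap]; exact mem_adaptedAt P _)

/-- Near `w`, the pairing of the covector with the total vector is the functional `(p, p^i)` applied
to `(1, q_1, …, q_k)`, and both depend smoothly on the point. -/
theorem contMDiff_couplingDefect (L : LagrangianDensity P k) (hk : 1 ≤ k) :
    ContMDiff (extendedModel n k) 𝓘(ℝ, ℝ) ∞ (couplingDefect L hk) := by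
  intro w
  refine ContMDiffAt.sub ?_ ((contMDiff_lagrangian L hk).comp contMDiff_extended_proj w)
  have h1 := contMDiffAt_extended_coord w
  have h2 : ContMDiffAt (extendedModel n k) 𝓘(ℝ, JetModel n (k - 1)) ∞
      (fun w' : ExtendedBundle P k =>
        ((1, shiftCoord (adaptedAt P (baseMap P k w.1).point) w'.1) : JetModel n (k - 1))) w :=
    contMDiffAt_const.prodMk_space
      ((contMDiffAt_shiftCoord_base hk w.1).comp w (contMDiff_extended_proj w))
  refine (h1.clm_apply h2).congr_of_eventuallyEq ?_
  filter_upwards [contMDiff_extended_proj.continuous.continuousAt.preimage_mem_nhds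
    (eventually_baseMap_mem w.1)] with w' hw'
  rw [totalVector_eq_symmL _ _ hw']
  rfl

/-! ### The two 1-forms as multiples of the differential of `ρ_ℝ` -/

theorem mfderiv_rhoR_surjective (w : ExtendedBundle P k) :
    ∃ u : TangentSpace (extendedModel n k) w,
      rhoRDiff w u = 1 := by
  let e := trivializationAt (JetModel n (k - 1) →L[ℝ] ℝ)
      (baseMap P k *ᵖ fun j : Jet P (k - 1) => Jet.Cotangent j) w.1
  -- Freezing the fibre coordinates of `w` gives a local section of `𝓦` through `w` along which
  -- `ρ_ℝ` is the time function; it pushes a vector with `dt = 1` to the one sought.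
  let σ : Jet P (2 * k - 1) → ExtendedBundle P k :=
    fun y => e.toOpenPartialHomeomorph.symm (y, (e w).2)
  have hw : w.1 ∈ e.baseSet := mem_baseSet_trivializationAt _ _ _
  have hσw : σ w.1 = w := e.symm_apply_mk_proj hw
  have hσ : ContMDiffAt 𝓘(ℝ, JetModel n (2 * k - 1)) (extendedModel n k) ∞ σ w.1 := by
    have h1 := (e.contMDiffOn_symm (IB := 𝓘(ℝ, JetModel n (2 * k - 1))) (n := ∞)).contMDiffAt
      (x := (w.1, (e w).2)) (e.open_target.mem_nhds (by rw [e.target_eq]; exact ⟨hw, mem_univ _⟩))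
    exact h1.comp w.1 (contMDiffAt_id.prodMk contMDiffAt_const)
  have h1 : MDifferentiableAt (extendedModel n k) 𝓘(ℝ, ℝ) (rhoR : ExtendedBundle P k → ℝ)
      (σ w.1) := (contMDiff_rhoR _).mdifferentiableAt (by simp)
  have h2 := mfderiv_comp w.1 h1 (hσ.mdifferentiableAt (by simp))
  have h3 : (rhoR ∘ σ : Jet P (2 * k - 1) → ℝ) =ᶠ[𝓝 w.1] Jet.time := by
    filter_upwards [e.open_baseSet.mem_nhds hw] with y hy
    exact congrArg Jet.time (e.proj_symm_apply' hy)
  rw [h3.mfderiv_eq] at h2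
  set X : Jet.Tangent w.1 := (Jet.tangentTriv w.1).symmL ℝ w.1
    ((1, 0) : JetModel n (2 * k - 1)) with hX
  have hX1 : Jet.dt w.1 X = (1 : ℝ) := Jet.dt_symmL w.1 (mem_baseSet_trivializationAt _ _ _) _
  have h4 := DFunLike.congr_fun h2 X
  rw [hσw] at h4
  exact ⟨_, h4.symm.trans hX1⟩

theorem clm_apply_eq_smul {X : Type*} [NormedAddCommGroup X] [NormedSpace ℝ X] (D : ℝ →L[ℝ] X)
    (c : ℝ) : D c = c • D 1 := by
  rw [← map_smul, smul_eq_mul, mul_one]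

/-- The map `j^{k-1} φ ∘ ρ_ℝ` factors through the line, so its differential is that of `ρ_ℝ` times
the total vector. -/
theorem couplingForm_apply (w : ExtendedBundle P k) (u : TangentSpace (extendedModel n k) w) :
    couplingForm w u = rhoRDiff w u *
      covector w (totalVector w.1) := by
  have h1 := mfderiv_comp w (mdifferentiableAt_prolong_rep w.1)
    ((contMDiff_rhoR w).mdifferentiableAt (by simp))
  have h2 := DFunLike.congr_fun h1 u
  have h3 := clm_apply_eq_smul (X := JetModel n (k - 1)) (mfderiv 𝓘(ℝ, ℝ) 𝓘(ℝ, JetModel n (k - 1))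
    (Jet.prolong (k - 1) w.1.rep) w.1.time) (rhoRDiff w u)
  refine (congrArg (covector w) (h2.trans h3)).trans ?_
  exact map_smul (covector w) _ _

/-- The pull-back of `dt` is the differential of `ρ_ℝ`, because the projections to the line commute.
-/
theorem lagrangianForm_apply (L : LagrangianDensity P k) (hk : 1 ≤ k) (w : ExtendedBundle P k)
    (u : TangentSpace (extendedModel n k) w) :
    lagrangianForm hk L w u = rhoRDiff w u *
      L.toFun (w.1.projTo k (by omega)) := by
  refine L.form_apply _ ?_
  have h1 := mfderiv_comp (I := extendedModel n k) (I' := 𝓘(ℝ, JetModel n k)) (I'' := 𝓘(ℝ, ℝ))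
    (g := Jet.time) (f := fun w' : ExtendedBundle P k => w'.1.projTo k (by omega)) w
    ((Jet.contMDiff_time _).mdifferentiableAt (by simp))
    ((((Jet.contMDiff_projTo (by omega)).comp contMDiff_extended_proj) w).mdifferentiableAt
      (by simp))
  have h2 : (Jet.time ∘ fun w' : ExtendedBundle P k => w'.1.projTo k (by omega)) = rhoR :=
    funext fun w' => Jet.time_projTo (by omega) w'.1
  rw [h2] at h1
  exact (DFunLike.congr_fun h1 u).symm

/-- Both forms are multiples of one nonzero covector, so they agree exactly when their coefficients
do. -/
theorem mem_hamiltonianSubmanifold_iff (L : LagrangianDensity P k) (hk : 1 ≤ k)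
    (w : ExtendedBundle P k) : w ∈ hamiltonianSubmanifold hk L ↔ couplingDefect L hk w = 0 := by
  change lagrangianForm hk L w = couplingForm w ↔ _
  rw [couplingDefect, sub_eq_zero]
  constructor
  · intro h
    obtain ⟨u, hu⟩ := mfderiv_rhoR_surjective w
    have h1 := DFunLike.congr_fun h u
    rw [lagrangianForm_apply, couplingForm_apply] at h1
    rw [hu] at h1
    simpa using h1.symm
  · intro h
    ext u
    rw [lagrangianForm_apply, couplingForm_apply, h]

/-! ### The Hamiltonian section -/

/-! ### Linear algebra of covectors adjusted along a fixed covector -/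

section Covectors

variable {V : Type*} [AddCommGroup V] [Module ℝ V] [TopologicalSpace V]

/-- The linear map sending a covector `α` to `α - α(T) d`. -/
def removeComponent (T : V) (d : V →L[ℝ] ℝ) : (V →L[ℝ] ℝ) →ₗ[ℝ] (V →L[ℝ] ℝ) where
  toFun α := α - α T • d
  map_add' α β := by
    rw [add_apply, add_smul]; abel
  map_smul' c α := by
    rw [smul_apply, smul_eq_mul, mul_smul, smul_sub]; rfl

/-- This lets `removeComponent` descend to the quotient by the multiples of `dt`. -/
theorem removeComponent_smul {T : V} {d : V →L[ℝ] ℝ} (h : d T = 1) (c : ℝ) :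
    removeComponent T d (c • d) = 0 := by
  change c • d - (c * d T) • d = 0
  rw [h, mul_one, sub_self]

theorem removeComponent_add_smul (T : V) (d α : V →L[ℝ] ℝ) (a : ℝ) :
    removeComponent T d α + a • d = α + (a - α T) • d := by
  ext v
  change α v - α T * d v + a * d v = α v + (a - α T) * d v
  ring

theorem add_smul_sub_of_eq {T : V} (d : V →L[ℝ] ℝ) {α : V →L[ℝ] ℝ} {a : ℝ} (h : a = α T) :
    α + (a - α T) • d = α := by
  rw [h, sub_self, zero_smul, add_zero]

/-- The adjusted covector keeps its vertical part. When `d T = 1`, its value on `T = S (1, τ)` is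
`c`, which forces the remaining component to be `c` minus the vertical part at `τ`: the abstract
form of `p = c - Σ p^i q_{i+1}`. -/
theorem add_smul_sub_comp {U : Type*} [NormedAddCommGroup U] [NormedSpace ℝ U]
    (S : ℝ × U →L[ℝ] V) {T : V} {d : V →L[ℝ] ℝ} {τ : U} (hT : T = S (1, τ))
    (hd : ∀ v, d (S v) = v.1) (α : V →L[ℝ] ℝ) (c : ℝ) :
    (α + (c - α T) • d).comp S =
      (α.comp (S.comp (ContinuousLinearMap.inr ℝ ℝ U))).comp (ContinuousLinearMap.snd ℝ ℝ U) +
        (c - α (S (0, τ))) • ContinuousLinearMap.fst ℝ ℝ U := by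
  have hdec : ∀ v : ℝ × U, α (S v) = v.1 * α (S (1, 0)) + α (S (0, v.2)) := by
    intro v
    have : v = v.1 • ((1, 0) : ℝ × U) + (0, v.2) := by
      refine Prod.ext ?_ ?_ <;> simp
    conv_lhs => rw [this]
    rw [map_add, map_smul, map_add, map_smul, smul_eq_mul]
  refine ContinuousLinearMap.ext fun v => ?_
  change α (S v) + (c - α T) * d (S v) = α (S (0, v.2)) + (c - α (S (0, τ))) * v.1
  rw [hd, hT, hdec, hdec (1, τ)]
  ring

end Covectors

/-! ### The splitting of `𝓦` as `𝓦_r × ℝ` -/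

/-- The representative of a class of covectors that vanishes on the total vector. -/
def normalizedCovector (y : Jet P (2 * k - 1)) :
    Jet.RestrictedCotangent (baseMap P k y) →ₗ[ℝ] Jet.Cotangent (baseMap P k y) :=
  (Jet.horizontalCovectors (baseMap P k y)).liftQ
    (removeComponent (totalVector y) (Jet.dt (baseMap P k y))) (by
      intro α hα
      obtain ⟨c, rfl⟩ := Jet.mem_horizontalCovectors.1 hα
      exact removeComponent_smul (dt_totalVector y) c)

/-- The point of `𝓦` over `z ∈ 𝓦_r` at which the coupling defect is `c`. -/
def liftPoint (L : LagrangianDensity P k) (hk : 1 ≤ k) (x : RestrictedBundle P k × ℝ) :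
    ExtendedBundle P k :=
  ⟨x.1.1, ((normalizedCovector x.1.1 x.1.2 +
    (x.2 + L.toFun (x.1.1.projTo k (by omega))) • Jet.dt (baseMap P k x.1.1) :
      Jet.Cotangent (baseMap P k x.1.1)))⟩

/-- In terms of a representative `α`, the lift adds the multiple of `dt` that brings the value on
the total vector to `c + L̂`. -/
theorem covector_liftPoint (L : LagrangianDensity P k) (hk : 1 ≤ k) (y : Jet P (2 * k - 1))
    (α : Jet.Cotangent (baseMap P k y)) (c : ℝ) :
    covector (liftPoint L hk (⟨y, (Submodule.Quotient.mk α :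
      Jet.RestrictedCotangent (baseMap P k y))⟩, c)) =
      α + (c + L.toFun (y.projTo k (by omega)) - α (totalVector y)) •
        Jet.dt (baseMap P k y) := removeComponent_add_smul _ _ α _

theorem restrictedBundle_induction {p : RestrictedBundle P k → Prop}
    (h : ∀ (y : Jet P (2 * k - 1)) (α : Jet.Cotangent (baseMap P k y)),
      p ⟨y, (Submodule.Quotient.mk α : Jet.RestrictedCotangent (baseMap P k y))⟩)
    (z : RestrictedBundle P k) : p z := by
  obtain ⟨y, x⟩ := z
  obtain ⟨α, rfl⟩ := Submodule.Quotient.mk_surjective _ x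
  exact h y α

theorem muW_liftPoint (L : LagrangianDensity P k) (hk : 1 ≤ k) (x : RestrictedBundle P k × ℝ) :
    muW (liftPoint L hk x) = x.1 := by
  obtain ⟨z, c⟩ := x
  induction z using restrictedBundle_induction with
  | h y α =>
    change (⟨y, (Submodule.Quotient.mk (covector (liftPoint L hk _)) :
      Jet.RestrictedCotangent (baseMap P k y))⟩ : RestrictedBundle P k) = ⟨y, _⟩
    refine congrArg (TotalSpace.mk y) ?_
    rw [covector_liftPoint]
    refine (Submodule.Quotient.eq _).2 ?_
    rw [add_sub_cancel_left]
    exact Jet.mem_horizontalCovectors.2 ⟨_, rfl⟩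

theorem couplingDefect_liftPoint (L : LagrangianDensity P k) (hk : 1 ≤ k)
    (x : RestrictedBundle P k × ℝ) : couplingDefect L hk (liftPoint L hk x) = x.2 := by
  obtain ⟨z, c⟩ := x
  induction z using restrictedBundle_induction with
  | h y α =>
    rw [couplingDefect, covector_liftPoint]
    change α (totalVector y) + (c + L.toFun (y.projTo k (by omega)) - α (totalVector y)) *
      Jet.dt (baseMap P k y) (totalVector y) - L.toFun (y.projTo k (by omega)) = c
    rw [dt_totalVector]
    ring

/-- When `c` is the defect of `w` itself, `c + L̂` is already the value of its covector on the total
vector, so the correction vanishes. -/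
theorem liftPoint_muW (L : LagrangianDensity P k) (hk : 1 ≤ k) (w : ExtendedBundle P k) :
    liftPoint L hk (muW w, couplingDefect L hk w) = w := by
  have h := (covector_liftPoint L hk w.1 (covector w) (couplingDefect L hk w)).trans
    (add_smul_sub_of_eq _ (sub_add_cancel _ _))
  exact congrArg (TotalSpace.mk w.1) h

/-- The covector of `liftPoint` in the coordinates `(p, p_A^i)`: `p` is determined by its value on
the total vector. -/
theorem covector_liftPoint_comp_symmL (L : LagrangianDensity P k) (hk : 1 ≤ k)
    (j₀ : Jet P (k - 1)) (x : RestrictedBundle P k × ℝ)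
    (hx : baseMap P k x.1.1 ∈ (Jet.tangentTriv j₀).baseSet) :
    (covector (liftPoint L hk x)).comp ((Jet.tangentTriv j₀).symmL ℝ (baseMap P k x.1.1)) =
      (Jet.restrictedCoord j₀ (baseMap P k x.1.1) x.1.2).comp
        (ContinuousLinearMap.snd ℝ ℝ (Jet.VertModel n (k - 1))) +
      (x.2 + L.toFun (x.1.1.projTo k (by omega)) -
        Jet.restrictedCoord j₀ (baseMap P k x.1.1) x.1.2
          (shiftCoord (adaptedAt P j₀.point) x.1.1)) •
        ContinuousLinearMap.fst ℝ ℝ (Jet.VertModel n (k - 1)) := by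
  obtain ⟨z, c⟩ := x
  induction z using restrictedBundle_induction with
  | h y α =>
    rw [covector_liftPoint]
    exact add_smul_sub_comp ((Jet.tangentTriv j₀).symmL ℝ (baseMap P k y))
      (totalVector_eq_symmL j₀ y hx) (Jet.dt_symmL j₀ hx) α _

/-- By `covector_liftPoint_comp_symmL` the fibre coordinates of the lift are the given `p^i`
together with `p = c + L̂ - Σ p^i q_{i+1}`, all smooth. -/
theorem contMDiff_liftPoint (L : LagrangianDensity P k) (hk : 1 ≤ k) :
    ContMDiff ((restrictedModel n k).prod 𝓘(ℝ, ℝ)) (extendedModel n k) ∞ (liftPoint L hk) := by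
  intro x
  have hp : ContMDiff ((restrictedModel n k).prod 𝓘(ℝ, ℝ)) 𝓘(ℝ, JetModel n (2 * k - 1)) ∞
      (fun x : RestrictedBundle P k × ℝ => x.1.1) :=
    contMDiff_restricted_proj.comp contMDiff_fst
  refine contMDiffAt_extended_iff.2 ⟨hp x, ?_⟩
  have hf : ContMDiffAt ((restrictedModel n k).prod 𝓘(ℝ, ℝ))
      𝓘(ℝ, Jet.VertModel n (k - 1) →L[ℝ] ℝ) ∞ (fun x' : RestrictedBundle P k × ℝ =>
        Jet.restrictedCoord (baseMap P k x.1.1) (baseMap P k x'.1.1) x'.1.2) x :=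
    (contMDiffAt_restricted_coord x.1).comp x contMDiffAt_fst
  have hτ : ContMDiffAt ((restrictedModel n k).prod 𝓘(ℝ, ℝ)) 𝓘(ℝ, Jet.VertModel n (k - 1)) ∞
      (fun x' : RestrictedBundle P k × ℝ =>
        shiftCoord (adaptedAt P (baseMap P k x.1.1).point) x'.1.1) x :=
    (contMDiffAt_shiftCoord_base hk x.1.1).comp x (hp x)
  have hL : ContMDiffAt ((restrictedModel n k).prod 𝓘(ℝ, ℝ)) 𝓘(ℝ, ℝ) ∞
      (fun x' : RestrictedBundle P k × ℝ => L.toFun (x'.1.1.projTo k (by omega))) x :=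
    ((contMDiff_lagrangian L hk).comp hp) x
  have hc := (contMDiffAt_snd.add hL).sub (hf.clm_apply hτ)
  let R : (Jet.VertModel n (k - 1) →L[ℝ] ℝ) →L[ℝ] (JetModel n (k - 1) →L[ℝ] ℝ) :=
    ContinuousLinearMap.precomp ℝ (ContinuousLinearMap.snd ℝ ℝ (Jet.VertModel n (k - 1)))
  have hR := (R.contDiff (n := ∞)).contMDiff.contMDiffAt.comp x hf
  have hs := hc.smul (contMDiffAt_const (I' := 𝓘(ℝ, JetModel n (k - 1) →L[ℝ] ℝ))
    (c := ContinuousLinearMap.fst ℝ ℝ (Jet.VertModel n (k - 1))))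
  refine (hR.add hs).congr_of_eventuallyEq ?_
  filter_upwards [hp.continuous.continuousAt.preimage_mem_nhds
    (eventually_baseMap_mem x.1.1)] with x' hx'
  exact covector_liftPoint_comp_symmL L hk _ x' hx'

/-- The diffeomorphism `𝓦 ≃ 𝓦_r × ℝ` given by `μ_𝓦` and the coupling defect. -/
def splitting (L : LagrangianDensity P k) (hk : 1 ≤ k) :
    ExtendedBundle P k ≃ₘ^∞⟮extendedModel n k, (restrictedModel n k).prod 𝓘(ℝ, ℝ)⟯
      (RestrictedBundle P k × ℝ) where
  toFun w := (muW w, couplingDefect L hk w)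
  invFun := liftPoint L hk
  left_inv := liftPoint_muW L hk
  right_inv x := Prod.ext (muW_liftPoint L hk x) (couplingDefect_liftPoint L hk x)
  contMDiff_toFun := contMDiff_muW.prodMk (contMDiff_couplingDefect L hk)
  contMDiff_invFun := contMDiff_liftPoint L hk

theorem liftPoint_zero_mem (L : LagrangianDensity P k) (hk : 1 ≤ k) (z : RestrictedBundle P k) :
    liftPoint L hk (z, 0) ∈ hamiltonianSubmanifold hk L := by
  rw [mem_hamiltonianSubmanifold_iff, couplingDefect_liftPoint]

theorem splitting_val (L : LagrangianDensity P k) (hk : 1 ≤ k) (w : hamiltonianSubmanifold hk L) :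
    splitting L hk w.1 = (muW w.1, 0) :=
  Prod.ext rfl ((mem_hamiltonianSubmanifold_iff L hk w.1).1 w.2)

theorem liftPoint_muW_val (L : LagrangianDensity P k) (hk : 1 ≤ k)
    (w : hamiltonianSubmanifold hk L) : liftPoint L hk (muW w.1, 0) = w.1 := by
  conv_rhs => rw [← liftPoint_muW L hk w.1]
  rw [(mem_hamiltonianSubmanifold_iff L hk w.1).1 w.2]

theorem contMDiff_liftPoint_zero (L : LagrangianDensity P k) (hk : 1 ≤ k) :
    ContMDiff (restrictedModel n k) (extendedModel n k) ∞
      (fun z : RestrictedBundle P k => liftPoint L hk (z, 0)) :=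
  (contMDiff_liftPoint L hk).comp (contMDiff_id.prodMk contMDiff_const)

/-- The restriction of `μ_𝓦` to the Hamiltonian submanifold, as a homeomorphism. -/
def restrictedHomeomorph (L : LagrangianDensity P k) (hk : 1 ≤ k) :
    hamiltonianSubmanifold hk L ≃ₜ RestrictedBundle P k where
  toFun w := muW w.1
  invFun z := ⟨liftPoint L hk (z, 0), liftPoint_zero_mem L hk z⟩
  left_inv w := Subtype.ext (liftPoint_muW_val L hk w)
  right_inv z := muW_liftPoint L hk (z, 0)
  continuous_toFun := contMDiff_muW.continuous.comp continuous_subtype_val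
  continuous_invFun := (contMDiff_liftPoint_zero L hk).continuous.subtype_mk _

/-! ### Dimensions of the models, and the local formula -/

theorem finrank_jetModel (n k : ℕ) : Module.finrank ℝ (JetModel n k) = 1 + (k + 1) * n := by
  simp [Module.finrank_prod, Module.finrank_pi_fintype]

/-- The identification of the model space of `𝓦_r` with a Euclidean space. -/
def restrictedModelEquiv (hk : 1 ≤ k) :
    (JetModel n (2 * k - 1) × (Jet.VertModel n (k - 1) →L[ℝ] ℝ)) ≃L[ℝ]
      EuclideanSpace ℝ (Fin (3 * k * n + 1)) :=
  haveI : FiniteDimensional ℝ (Jet.VertModel n (k - 1) →L[ℝ] ℝ) :=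
    inferInstance
  ContinuousLinearEquiv.ofFinrankEq (by
    have h : Module.finrank ℝ (Jet.VertModel n (k - 1) →L[ℝ] ℝ) = k * n := by
      rw [← (LinearMap.toContinuousLinearMap (𝕜 := ℝ) (E := Jet.VertModel n (k - 1))
        (F' := ℝ)).finrank_eq, Module.finrank_linearMap]
      simp only [Module.finrank_pi_fintype, finrank_euclideanSpace, Fintype.card_fin,
        Finset.sum_const, Finset.card_univ, Module.finrank_self, mul_one, smul_eq_mul]
      -- There are `k - 1 + 1 = k` momentum blocks of size `n`; with `1 + 2k n` jet coordinates the
      -- total is `3 k n + 1`.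
      rw [Nat.sub_add_cancel hk]
    rw [Module.finrank_prod, finrank_jetModel, h, finrank_euclideanSpace, Fintype.card_fin,
      Nat.sub_add_cancel (by omega)]
    ring)

/-- The identification of the model space of `𝓦` with that of `𝓦_r × ℝ`. -/
def extendedModelEquiv (n k : ℕ) :
    ((JetModel n (2 * k - 1) × (Jet.VertModel n (k - 1) →L[ℝ] ℝ)) × ℝ) ≃L[ℝ]
      (JetModel n (2 * k - 1) × (JetModel n (k - 1) →L[ℝ] ℝ)) :=
  -- No particular isomorphism is needed, so it suffices that the extra factor `ℝ` accounts for the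
  -- one coordinate `p`.
  ContinuousLinearEquiv.ofFinrankEq (by
    have h : Module.finrank ℝ (JetModel n (k - 1) →L[ℝ] ℝ) =
        Module.finrank ℝ (Jet.VertModel n (k - 1) →L[ℝ] ℝ) + 1 := by
      rw [← (LinearMap.toContinuousLinearMap (𝕜 := ℝ) (E := Jet.VertModel n (k - 1))
        (F' := ℝ)).finrank_eq, ← (LinearMap.toContinuousLinearMap (𝕜 := ℝ)
        (E := JetModel n (k - 1)) (F' := ℝ)).finrank_eq, Module.finrank_linearMap,
        Module.finrank_linearMap, Module.finrank_prod, Module.finrank_self, mul_one, mul_one,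
        add_comm]
    rw [Module.finrank_prod, Module.finrank_prod (M' := Jet.VertModel n (k - 1) →L[ℝ] ℝ),
      Module.finrank_prod (M' := JetModel n (k - 1) →L[ℝ] ℝ), Module.finrank_self, h, add_assoc])

/-- Evaluating the covector on the total vector gives `p + Σ p^i q_{i+1}`, evaluating the Lagrangian
on a vector with `dt = 1` gives `l`, and on `𝓦_o` the two agree. -/
theorem hamiltonian_eq (L : LagrangianDensity P k) (hk : 1 ≤ k) {w : ExtendedBundle P k}
    (hw : w ∈ hamiltonianSubmanifold hk L) (e : AdaptedChart P) (he : w.1.point ∈ e.chart.source)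
    {p : ℝ} {q : ℕ → FibreModel n →L[ℝ] ℝ} {l : ℝ}
    (hα : covector w = p • Jet.dt (baseMap P k w.1) +
      ∑ i ∈ Finset.range k, (q i).comp (Jet.dq e i (baseMap P k w.1)))
    (hl : L.form (w.1.projTo k (by omega)) = l • Jet.dt (w.1.projTo k (by omega))) :
    p = l - ∑ i ∈ Finset.range k, q i (w.1.coord e (i + 1)) := by
  have h1 : covector w (totalVector w.1) = p + ∑ i ∈ Finset.range k, q i (w.1.coord e (i + 1)) := by
    rw [hα, add_apply, sum_apply, smul_apply, dt_totalVector, smul_eq_mul, mul_one]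
    congr 1
    refine Finset.sum_congr rfl fun i hi => ?_
    rw [ContinuousLinearMap.comp_apply,
      dq_totalVector e w.1 he (by have := Finset.mem_range.1 hi; omega)]
  have h2 : L.toFun (w.1.projTo k (by omega)) = l := by
    rw [LagrangianDensity.toFun, hl, smul_apply,
      Jet.dt_symmL _ (mem_baseSet_trivializationAt _ _ _), smul_eq_mul, mul_one]
  have h3 := (mem_hamiltonianSubmanifold_iff L hk w).1 hw
  rw [couplingDefect, h1, h2] at h3
  linarith

end HighOrderMechanics

end

/-! ### Assembly of the theorem -/

open HighOrderMechanics in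
theorem mainTheorem8 {n k : ℕ} (hk : 1 ≤ k) {E : Type*} [TopologicalSpace E] [T2Space E]
    [SecondCountableTopology E] [ChartedSpace (EuclideanSpace ℝ (Fin (n + 1))) E]
    [IsManifold (𝓡 (n + 1)) ∞ E] (P : ConfigBundle n E) (L : LagrangianDensity P k) :
    ∃ _ : ChartedSpace (EuclideanSpace ℝ (Fin (3 * k * n + 1))) (hamiltonianSubmanifold hk L),
      IsManifold (𝓡 (3 * k * n + 1)) ∞ (hamiltonianSubmanifold hk L) ∧
      IsSmoothEmbedding (𝓡 (3 * k * n + 1)) (extendedModel n k) ∞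
        (Subtype.val : hamiltonianSubmanifold hk L → ExtendedBundle P k) ∧
      IsImmersionOfComplement ℝ (𝓡 (3 * k * n + 1)) (extendedModel n k) ∞
        (Subtype.val : hamiltonianSubmanifold hk L → ExtendedBundle P k) ∧
      (∀ w : hamiltonianSubmanifold hk L, IsCompl
        (LinearMap.range (mfderiv (𝓡 (3 * k * n + 1)) (extendedModel n k)
          (Subtype.val : hamiltonianSubmanifold hk L → ExtendedBundle P k) w).toLinearMap)
        (LinearMap.ker (mfderiv (extendedModel n k) (restrictedModel n k)
          (muW : ExtendedBundle P k → RestrictedBundle P k) w.1).toLinearMap)) ∧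
      ∃ Φ : hamiltonianSubmanifold hk L ≃ₘ^∞⟮𝓡 (3 * k * n + 1), restrictedModel n k⟯
          RestrictedBundle P k,
        (∀ w, Φ w = muW w.1) ∧
        ∃ h : RestrictedBundle P k → ExtendedBundle P k,
          ContMDiff (restrictedModel n k) (extendedModel n k) ∞ h ∧
          (∀ z, muW (h z) = z) ∧
          (∀ z, h z = (Φ.symm z).1) ∧
          Set.range h = hamiltonianSubmanifold hk L ∧
          ∀ (z : RestrictedBundle P k) (e : AdaptedChart P), (h z).1.point ∈ e.chart.source →
            ∀ (p : ℝ) (q : ℕ → FibreModel n →L[ℝ] ℝ) (l : ℝ),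
              (h z).2 = p • Jet.dt (baseMap P k (h z).1) +
                ∑ i ∈ Finset.range k, (q i).comp (Jet.dq e i (baseMap P k (h z).1)) →
              L.form ((h z).1.projTo k (by omega)) = l • Jet.dt ((h z).1.projTo k (by omega)) →
              p = l - ∑ i ∈ Finset.range k, q i ((h z).1.coord e (i + 1)) := by
  -- The smooth structure of `𝓦_o` is pulled back from `𝓦_r`, so that `μ_𝓦 ∘ j_o` is a
  -- diffeomorphism by construction and what needs proof is that the inclusion is an embedding.
  refine ⟨transportChartedSpace (restrictedModel n k) (restrictedHomeomorph L hk)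
    (restrictedModelEquiv hk), ?_⟩
  let _ := transportChartedSpace (restrictedModel n k) (restrictedHomeomorph L hk)
    (restrictedModelEquiv hk)
  have hM : IsManifold (𝓡 (3 * k * n + 1)) ∞ (hamiltonianSubmanifold hk L) :=
    isManifold_transport (J := restrictedModel n k) _ _
  let Φ : hamiltonianSubmanifold hk L ≃ₘ^∞⟮𝓡 (3 * k * n + 1), restrictedModel n k⟯
      RestrictedBundle P k := transportDiffeomorph (J := restrictedModel n k)
    (restrictedHomeomorph L hk) (restrictedModelEquiv hk)
  have himm : IsImmersionOfComplement ℝ (𝓡 (3 * k * n + 1)) (extendedModel n k) ∞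
      (Subtype.val : hamiltonianSubmanifold hk L → ExtendedBundle P k) :=
    -- The splitting turns the inclusion into the slice at defect zero, with complement `ℝ`:
    -- codimension one.
    isImmersionOfComplement_of_diffeomorph _ Φ (splitting L hk) (splitting_val L hk)
      (restrictedModelEquiv hk) (extendedModelEquiv n k)
  refine ⟨hM, ⟨himm.isImmersion, IsEmbedding.subtypeVal⟩, himm, ?_, Φ, fun _ => rfl,
    fun z => liftPoint L hk (z, 0), contMDiff_liftPoint_zero L hk,
    fun z => muW_liftPoint L hk (z, 0), fun _ => rfl, ?_, ?_⟩
  · intro w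
    exact isCompl_range_ker_mfderiv Φ (g := muW) (fun _ => rfl)
      ((himm.contMDiff w).mdifferentiableAt (by simp))
      ((contMDiff_muW w.1).mdifferentiableAt (by simp))
  · refine Subset.antisymm (range_subset_iff.2 fun z => liftPoint_zero_mem L hk z) fun w hw => ?_
    exact ⟨muW w, liftPoint_muW_val L hk ⟨w, hw⟩⟩
  · intro z e he p q l hα hl
    exact hamiltonian_eq L hk (liftPoint_zero_mem L hk z) e he hα hl
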